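/- Let $(R,\mathfrak m)$ be a commutative Noetherian local ring; all modules are finitely generated. The depth of the zero module is $\infty$. Call $R$ Gorenstein if it has finite injective dimension over itself. Call a Cohen–Macaulay local ring $R$ almost Gorenstein (in the sense of Goto–Takahashi–Taniguchi) if $R$ has a canonical module $\omega$ (a maximal Cohen–Macaulay module of type $1$ and of finite injective dimension) and there is an exact sequence of $R$-modules $0\to R\to\omega\to C\to 0$ such that $\mu_R(C)=e^0_{\mathfrak m}(C)$. Here $\mu_R(C)$ is the minimal number of generators of $C$, and $e^0_{\mathfrak m}(C)=\lim_{n\to\infty} s!\,\ell_R(C/\mathfrak m^nC)/n^s$ with $s=\dim C$ is the multiplicity of $C$ with respect to $\mathfrak m$, which is $0$ if $C=0$. Say that $R$ satisfies $(ES^R_1)$ if every $R$-module $X$ with $\operatorname{Ext}^i_R(X,R)=0$ for all $i>0$ satisfies $(\widetilde{S_1})$, that is, $\operatorname{depth} X_{\mathfrak p}\ge\min\{1,\operatorname{depth} R_{\mathfrak p}\}$ for every prime ideal $\mathfrak p$ of $R$. **Corollary 4.6 (partial Auslander–Reiten conjecture).** Let $R$ be an almost Gorenstein Cohen–Macaulay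 local ring that is not Gorenstein, and assume that $R$ satisfies $(ES^R_1)$. Let $M$ be an $R$-module with $\operatorname{Ext}^i_R(M,R)=0$ for all $i>0$. Then $M$ is free. -/

import Mathlib

open CategoryTheory Abelian RingTheory.Sequence Filter Topology

universe u

namespace LocalAlg

/-- The depth of a finitely generated module `M` over a Noetherian local ring `(R, 𝔪)`: the supremum
of the lengths of `M`-sequences in `𝔪`. For `M ≠ 0` finitely generated, weakly regular sequences in
`𝔪` are regular by Nakayama's lemma; for `M = 0` one gets the usual convention `depth 0 = ∞`. -/
noncomputable def depth (R : Type*) [CommRing R] [IsLocalRing R]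
    (M : Type*) [AddCommGroup M] [Module R M] : ℕ∞ :=
  ⨆ (rs : List R) (_ : IsWeaklyRegular M rs) (_ : ∀ r ∈ rs, r ∈ IsLocalRing.maximalIdeal R),
    (rs.length : ℕ∞)

/-- A Noetherian local ring is Cohen–Macaulay if its depth equals its Krull dimension. -/
def IsCohenMacaulay (R : Type*) [CommRing R] [IsLocalRing R] : Prop :=
  ((depth R R : ℕ∞) : WithBot ℕ∞) = ringKrullDim R

/-- A (finitely generated) module is maximal Cohen–Macaulay if its depth is `dim R`. -/
def IsMaximalCohenMacaulay (R : Type*) [CommRing R] [IsLocalRing R]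
    (M : Type*) [AddCommGroup M] [Module R M] : Prop :=
  ((depth R M : ℕ∞) : WithBot ℕ∞) = ringKrullDim R

/-- `Ext^{i}_R(M, N) = 0` for all `i > 0`. -/
def ExtPosVanishes (R : Type u) [CommRing R] (M N : Type u)
    [AddCommGroup M] [Module R M] [AddCommGroup N] [Module R N] : Prop :=
  ∀ i : ℕ, 0 < i → Subsingleton (Ext (ModuleCat.of R M) (ModuleCat.of R N) i)

/-- The injective dimension of `M` over `R` is finite. -/
def FiniteInjectiveDimension (R : Type u) [CommRing R]
    (M : Type u) [AddCommGroup M] [Module R M] : Prop :=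
  ∃ n : ℕ, HasInjectiveDimensionLT (ModuleCat.of R M) n

/-- A Noetherian local ring is Gorenstein if it has finite injective dimension over itself. -/
def IsGorenstein (R : Type u) [CommRing R] : Prop :=
  FiniteInjectiveDimension R R

/-- The (Cohen–Macaulay) type `dim_k Ext^t_R(k, M)`, with `t = depth M` and `k` the residue field.
The module `Ext^t_R(k, M)` is killed by the maximal ideal, so its length over `R` is its dimension
over `k`. -/
noncomputable def cmType (R : Type u) [CommRing R] [IsLocalRing R]
    (M : Type u) [AddCommGroup M] [Module R M] : ℕ∞ :=
  Module.length R
    (Ext (ModuleCat.of R (IsLocalRing.ResidueField R)) (ModuleCat.of R M) (depth R M).toNat)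

/-- A canonical module of a Cohen–Macaulay local ring: a finitely generated maximal Cohen–Macaulay
module of type one and of finite injective dimension. -/
structure IsCanonicalModule (R : Type u) [CommRing R] [IsLocalRing R]
    (ω : Type u) [AddCommGroup ω] [Module R ω] : Prop where
  finite : Module.Finite R ω
  maximalCohenMacaulay : IsMaximalCohenMacaulay R ω
  type_one : cmType R ω = 1
  finiteInjectiveDimension : FiniteInjectiveDimension R ω

/-- The multiplicity of the finitely generated module `M` with respect to the maximal ideal `𝔪` is
`e`, i.e. `e = lim_n s! · ℓ(M / 𝔪ⁿ M) / n ^ s`, where `s = dim M` (and `e = 0` for `M = 0`). -/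
def HasMultiplicity (R : Type*) [CommRing R] [IsLocalRing R]
    (M : Type*) [AddCommGroup M] [Module R M] (e : ℝ) : Prop :=
  let s : ℕ := ((Module.supportDim R M).unbotD 0).toNat
  Tendsto (fun n : ℕ ↦ (s.factorial : ℝ) *
      ((Module.length R (M ⧸ (IsLocalRing.maximalIdeal R ^ n • (⊤ : Submodule R M)))).toNat : ℝ) /
        (n : ℝ) ^ s) atTop (𝓝 e)

/-- An almost Gorenstein local ring in the sense of Goto–Takahashi–Taniguchi (for a
Cohen–Macaulay local ring `R`): `R` has a canonical module `ω`, and there is an exact sequence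
`0 → R → ω → C → 0` such that the minimal number of generators of `C` equals the multiplicity of
`C` with respect to the maximal ideal. -/
def IsAlmostGorenstein (R : Type u) [CommRing R] [IsLocalRing R] : Prop :=
  ∃ (ω : Type u) (_ : AddCommGroup ω) (_ : Module R ω)
    (C : Type u) (_ : AddCommGroup C) (_ : Module R C) (f : R →ₗ[R] ω) (g : ω →ₗ[R] C),
    IsCanonicalModule R ω ∧
    Function.Injective f ∧ Function.Exact f g ∧ Function.Surjective g ∧
    HasMultiplicity R C ((⊤ : Submodule R C).spanFinrank : ℝ)

/-- The condition `(S̃_n)`: `depth M_𝔭 ≥ min {n, depth R_𝔭}` for every prime ideal `𝔭`. -/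
def SatisfiesSTilde (R : Type*) [CommRing R] (M : Type*) [AddCommGroup M] [Module R M]
    (n : ℕ) : Prop :=
  ∀ (p : Ideal R) [p.IsPrime],
    min (n : ℕ∞) (depth (Localization.AtPrime p) (Localization.AtPrime p)) ≤
      depth (Localization.AtPrime p) (LocalizedModule p.primeCompl M)

/-- The condition `(ES^C_n)` on `R`: each finitely generated `R`-module `X` with
`Ext^{>0}_R(X, C) = 0` satisfies `(S̃_n)`. -/
def SatisfiesES (R : Type u) [CommRing R] (C : Type u) [AddCommGroup C] [Module R C]
    (n : ℕ) : Prop :=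
  ∀ (X : Type u) [AddCommGroup X] [Module R X], Module.Finite R X →
    ExtPosVanishes R X C → SatisfiesSTilde R X n

end LocalAlg

section

open scoped Pointwise

/-! ### Depth measured by Ext from the residue field -/

section DepthExt

variable {R : Type u} [CommRing R]

/-! Write `k` for the residue field and `d` for the dimension of `R`. Since `R` is not Gorenstein,
the embedding of `R` into `ω` is not onto, so `C ≠ 0`. The vanishing of `Ext^{>0}(M, R)` and the
finite injective dimension of `ω` give `Ext^i(M, C) = 0` for all large `i`. The module `C` has depth
at least `d - 1` by the long exact sequence and dimension at most `d - 1`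
(`supportDim_cokernel_le`), so it is Cohen–Macaulay, and `μ(C) = e(C)` makes it an Ulrich module:
modulo a superficial sequence of length `dim C` it becomes a module of finite length equal to its
number of generators, hence killed by the maximal ideal. Every reduction preserves the vanishing of
high Ext, so one reaches a nonzero `k`-vector space `D` with `Ext^i(M, D) = 0` for large `i`. As `k`
embeds in `D`, this forces finite projective dimension of `M`, and together with `Ext^{>0}(M, R) =
0` it makes `M` free (`Module.free_of_extPosVanishes_of_subsingleton_ext`).

Superficial elements can be missing when the residue field is finite. Before each quotient the
current ring `S` is therefore replaced by `S[X]` localized at `𝔪 S[X]`, where `∑ a i * X ^ i`, with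
the `a i` generating `𝔪`, is superficial. This is McCoy's theorem on zero divisors in polynomial
rings, applied to the associated graded module (`exists_smul_mem_of_mulCoeff_mem`). Only the ring
acting on `C` grows: `M` and all its Ext modules stay over `R`, and flatness of `S → S'` carries the
vanishing along (`subsingleton_ext_tensorProduct`).

Multiplicities enter only through inequalities for Hilbert–Samuel functions.
`exists_hilbertSamuel_bound` yields `L ≥ μ(C)` such that the function grows at least like `L *
choose j s`, and `L = μ(C)` produces `D`. The limit defining `e(C)` gives `L ≤ e(C) = μ(C)`. -/

theorem ModuleCat.shortExact_of_linearMap {A B C : Type u} [AddCommGroup A] [Module R A]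
    [AddCommGroup B] [Module R B] [AddCommGroup C] [Module R C] {f : A →ₗ[R] B} {g : B →ₗ[R] C}
    (hf : Function.Injective f) (hfg : Function.Exact f g) (hg : Function.Surjective g) :
    (ModuleCat.shortComplexOfCompEqZero f g hfg.linearMap_comp_eq_zero).ShortExact where
  exact := ModuleCat.shortComplex_exact _ hfg
  mono_f := (ModuleCat.mono_iff_injective _).mpr hf
  epi_g := (ModuleCat.epi_iff_surjective _).mpr hg

theorem subsingleton_ext_of_exact_covariant {A B C : Type u} [AddCommGroup A] [Module R A]
    [AddCommGroup B] [Module R B] [AddCommGroup C] [Module R C] {f : A →ₗ[R] B} {g : B →ₗ[R] C}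
    (hf : Function.Injective f) (hfg : Function.Exact f g) (hg : Function.Surjective g)
    (X : ModuleCat.{u} R) (i : ℕ) (hB : Subsingleton (Ext X (ModuleCat.of R B) i))
    (hA : Subsingleton (Ext X (ModuleCat.of R A) (i + 1))) :
    Subsingleton (Ext X (ModuleCat.of R C) i) := by
  refine subsingleton_of_forall_eq 0 fun x ↦ ?_
  obtain ⟨y, rfl⟩ := Ext.covariant_sequence_exact₃ X
    (ModuleCat.shortExact_of_linearMap hf hfg hg) x rfl (hA.elim _ _)
  rw [show y = 0 from hB.elim _ _, Ext.zero_comp]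

/-- `Ext^i_R(k, M) = 0` for all `i < n`, i.e. `M` has depth at least `n`. -/
def ExtResidueVanishes (R : Type u) [CommRing R] [IsLocalRing R]
    (M : Type u) [AddCommGroup M] [Module R M] (n : ℕ) : Prop :=
  ∀ i < n, Subsingleton (Ext (ModuleCat.of R (IsLocalRing.ResidueField R)) (ModuleCat.of R M) i)

variable [IsLocalRing R]

theorem IsLocalRing.annihilator_residueField :
    Module.annihilator R (IsLocalRing.ResidueField R) = IsLocalRing.maximalIdeal R :=
  Ideal.annihilator_quotient

theorem ExtResidueVanishes.mono {M : Type u} [AddCommGroup M] [Module R M] {m n : ℕ}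
    (h : ExtResidueVanishes R M n) (hmn : m ≤ n) : ExtResidueVanishes R M m :=
  fun i hi ↦ h i (hi.trans_le hmn)

theorem ExtResidueVanishes.of_exact {n : ℕ} {A B C : Type u} [AddCommGroup A] [Module R A]
    [AddCommGroup B] [Module R B] [AddCommGroup C] [Module R C] {f : A →ₗ[R] B} {g : B →ₗ[R] C}
    (hf : Function.Injective f) (hfg : Function.Exact f g) (hg : Function.Surjective g)
    (hA : ExtResidueVanishes R A (n + 1)) (hB : ExtResidueVanishes R B n) :
    ExtResidueVanishes R C n :=
  fun i hi ↦ subsingleton_ext_of_exact_covariant hf hfg hg _ i (hB i hi) (hA (i + 1) (by omega))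

theorem ExtResidueVanishes.quotSMulTop {n : ℕ} {M : Type u} [AddCommGroup M] [Module R M] {y : R}
    (hy : IsSMulRegular M y) (hM : ExtResidueVanishes R M (n + 1)) :
    ExtResidueVanishes R (QuotSMulTop y M) n :=
  .of_exact (f := LinearMap.lsmul R M y) hy (LinearMap.exact_lsmul_mkQ_smul_top M y)
    (Submodule.mkQ_surjective _) hM (hM.mono n.le_succ)

theorem ExtResidueVanishes.eq_zero_of_smul {M : Type u} [AddCommGroup M] [Module R M]
    (hM : ExtResidueVanishes R M 1) {v : M} (hv : ∀ r ∈ IsLocalRing.maximalIdeal R, r • v = 0) :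
    v = 0 := by
  have h0 : Subsingleton (ModuleCat.of R (IsLocalRing.ResidueField R) ⟶ ModuleCat.of R M) :=
    Ext.addEquiv₀.subsingleton_congr.mp (hM 0 one_pos)
  have h1 : Subsingleton (IsLocalRing.ResidueField R →ₗ[R] M) :=
    (ModuleCat.homAddEquiv (M := ModuleCat.of R (IsLocalRing.ResidueField R))
      (N := ModuleCat.of R M)).symm.toEquiv.subsingleton
  let φ : IsLocalRing.ResidueField R →ₗ[R] M :=
    Submodule.liftQ (IsLocalRing.maximalIdeal R) (LinearMap.toSpanSingleton R M v)
      fun r hr ↦ by simpa using hv r hr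
  rw [← one_smul R v]
  exact LinearMap.congr_fun (h1.elim φ 0) (Submodule.Quotient.mk 1)

theorem IsLocalRing.maximalIdeal_smul_top_lt {M : Type u} [AddCommGroup M] [Module R M]
    [Module.Finite R M] [Nontrivial M] :
    IsLocalRing.maximalIdeal R • (⊤ : Submodule R M) < ⊤ :=
  (Submodule.top_ne_ideal_smul_of_le_jacobson_annihilator
    (IsLocalRing.maximalIdeal_le_jacobson _)).symm.lt_top

theorem IsLocalRing.isRegular_of_isWeaklyRegular {M : Type u} [AddCommGroup M] [Module R M]
    [Module.Finite R M] [Nontrivial M] {rs : List R} (h : IsWeaklyRegular M rs)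
    (hrs : ∀ r ∈ rs, r ∈ IsLocalRing.maximalIdeal R) : IsRegular M rs :=
  ⟨h, fun he ↦ (IsLocalRing.maximalIdeal_smul_top_lt (R := R) (M := M)).not_ge
    (he.le.trans (Submodule.smul_mono_left (Ideal.span_le.mpr hrs)))⟩

variable [IsNoetherianRing R]

/-- A finitely generated module with zero socle has a regular element in the maximal ideal. -/
theorem IsLocalRing.exists_isSMulRegular {M : Type u} [AddCommGroup M] [Module R M]
    [Module.Finite R M]
    (hM : ∀ v : M, (∀ r ∈ IsLocalRing.maximalIdeal R, r • v = 0) → v = 0) :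
    ∃ y ∈ IsLocalRing.maximalIdeal R, IsSMulRegular M y := by
  have h1 : Subsingleton (IsLocalRing.ResidueField R →ₗ[R] M) := by
    refine subsingleton_of_forall_eq 0 fun φ ↦ LinearMap.ext fun x ↦ hM _ fun r hr ↦ ?_
    rw [← map_smul, Module.mem_annihilator.mp
      ((IsLocalRing.annihilator_residueField (R := R)).symm ▸ hr), map_zero]
  obtain ⟨y, hy, hr⟩ := IsSMulRegular.subsingleton_linearMap_iff.mp h1
  exact ⟨y, IsLocalRing.annihilator_residueField (R := R) ▸ hy, hr⟩

theorem ExtResidueVanishes.of_isWeaklyRegular {M : Type u} [AddCommGroup M] [Module R M]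
    [Module.Finite R M] [Nontrivial M] {rs : List R} (h : IsWeaklyRegular M rs)
    (hrs : ∀ r ∈ rs, r ∈ IsLocalRing.maximalIdeal R) : ExtResidueVanishes R M rs.length := by
  have : Module.Finite R (ModuleCat.of R (IsLocalRing.ResidueField R)) :=
    inferInstanceAs (Module.Finite R (IsLocalRing.ResidueField R))
  have : Module.Finite R (ModuleCat.of R M) := ‹Module.Finite R M›
  refine ModuleCat.subsingleton_ext_of_exists_isRegular (IsLocalRing.maximalIdeal R)
    (ModuleCat.of R (IsLocalRing.ResidueField R)) ?_ (ModuleCat.of R M)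
    IsLocalRing.maximalIdeal_smul_top_lt rs hrs (IsLocalRing.isRegular_of_isWeaklyRegular h hrs)
  rw [Module.support_eq_zeroLocus]
  exact (congrArg _ (congrArg _ IsLocalRing.annihilator_residueField)).le

theorem ExtResidueVanishes.exists_isRegular {n : ℕ} {M : Type u} [AddCommGroup M] [Module R M]
    [Module.Finite R M] [Nontrivial M] (h : ExtResidueVanishes R M n) :
    ∃ rs : List R, rs.length = n ∧ (∀ r ∈ rs, r ∈ IsLocalRing.maximalIdeal R) ∧ IsRegular M rs := by
  have : Module.Finite R (ModuleCat.of R (IsLocalRing.ResidueField R)) :=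
    inferInstanceAs (Module.Finite R (IsLocalRing.ResidueField R))
  have : Module.Finite R (ModuleCat.of R M) := ‹Module.Finite R M›
  refine ModuleCat.exists_isRegular_of_exists_subsingleton_ext (IsLocalRing.maximalIdeal R) n
    (ModuleCat.of R M) IsLocalRing.maximalIdeal_smul_top_lt
    (ModuleCat.of R (IsLocalRing.ResidueField R)) ?_ h
  rw [Module.support_eq_zeroLocus]
  exact congrArg _ (congrArg _ IsLocalRing.annihilator_residueField)

/-- If `n` is at most the depth of `M`, then `Ext^i_R(k, M) = 0` for all `i < n`. -/
theorem LocalAlg.extResidueVanishes_of_le_depth {n : ℕ} {M : Type u} [AddCommGroup M] [Module R M]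
    [Module.Finite R M] (h : (n : ℕ∞) ≤ LocalAlg.depth R M) : ExtResidueVanishes R M n := by
  cases subsingleton_or_nontrivial M with
  | inl hM =>
    intro i _
    have : Limits.IsZero (ModuleCat.of R M) := ModuleCat.isZero_of_subsingleton _
    exact subsingleton_of_forall_eq 0 fun x ↦ by
      rw [← x.comp_mk₀_id, this.eq_of_src (𝟙 _) 0, Ext.mk₀_zero, Ext.comp_zero]
  | inr hM =>
    rcases n with _ | n
    · exact fun i hi ↦ absurd hi (by omega)
    by_contra hc
    have : LocalAlg.depth R M ≤ n := by
      refine iSup_le fun rs ↦ iSup_le fun h1 ↦ iSup_le fun h2 ↦ ?_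
      by_contra hlt
      have hlt : n + 1 ≤ rs.length := by
        rw [not_le] at hlt
        exact_mod_cast hlt
      exact hc ((ExtResidueVanishes.of_isWeaklyRegular h1 h2).mono hlt)
    have := h.trans this
    norm_cast at this
    omega

end DepthExt

/-! ### Lengths, and the bound for modules with simple socle -/

section Length

variable {R : Type*} [CommRing R]

theorem Module.length_le_add_of_exact {A B C : Type*} [AddCommGroup A] [Module R A]
    [AddCommGroup B] [Module R B] [AddCommGroup C] [Module R C] {f : A →ₗ[R] B} {g : B →ₗ[R] C}
    (hfg : Function.Exact f g) : Module.length R B ≤ Module.length R A + Module.length R C := by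
  rw [Module.length_eq_add_of_exact (LinearMap.ker g).subtype g.rangeRestrict
    (Submodule.subtype_injective _) g.surjective_rangeRestrict
    (by rw [LinearMap.exact_iff]; simp)]
  refine add_le_add ?_ (Module.length_le_of_injective _ (Submodule.subtype_injective _))
  rw [LinearMap.exact_iff.mp hfg]
  exact Module.length_le_of_surjective f.rangeRestrict f.surjective_rangeRestrict

/-- If the lengths of `M / Iⁿ M` are bounded, then `Iⁿ M = 0` for some `n`. -/
theorem Submodule.exists_pow_smul_eq_bot_of_length_le [IsLocalRing R] {M : Type*} [AddCommGroup M]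
    [Module R M] [IsNoetherian R M] {I : Ideal R} (hI : I ≤ IsLocalRing.maximalIdeal R) {L k : ℕ}
    (h : ∀ n ≥ k, Module.length R (M ⧸ (I ^ n • (⊤ : Submodule R M))) ≤ L) :
    ∃ n ≥ k, I ^ n • (⊤ : Submodule R M) = ⊥ := by
  have hanti : ∀ n, I ^ (n + 1) • (⊤ : Submodule R M) ≤ I ^ n • ⊤ := fun n ↦
    Submodule.smul_mono_left (Ideal.pow_le_pow_right n.le_succ)
  have key : ∃ n ≥ k, I ^ (n + 1) • (⊤ : Submodule R M) = I ^ n • ⊤ := by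
    by_contra! hne
    -- A chain that never stabilizes gains at least one unit of length per step, against the bound
    -- `L`; once it stabilizes, Nakayama's lemma gives zero.
    have hgrow : ∀ j : ℕ, (j : ℕ∞) ≤ Module.length R (M ⧸ (I ^ (k + j) • (⊤ : Submodule R M))) := by
      intro j
      induction j with
      | zero => simp
      | succ j ih =>
        rw [Module.length_quotient] at ih ⊢
        push_cast
        refine (add_le_add_left ih 1).trans ?_
        exact Order.coheight_add_one_le (lt_of_le_of_ne (hanti _) (hne _ (Nat.le_add_right k j)))
    have := (hgrow (L + 1)).trans (h _ (by omega))
    norm_cast at this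
    omega
  obtain ⟨n, hn, he⟩ := key
  refine ⟨n, hn, Submodule.eq_bot_of_le_smul_of_le_jacobson_bot I _ (IsNoetherian.noetherian _) ?_
    (hI.trans (IsLocalRing.maximalIdeal_le_jacobson _))⟩
  rw [← Submodule.mul_smul, ← pow_succ', he]

theorem Module.supportDim_le_of_annihilator_le {M N : Type*} [AddCommGroup M] [Module R M]
    [Module.Finite R M] [AddCommGroup N] [Module R N] [Module.Finite R N]
    (h : Module.annihilator R M ≤ Module.annihilator R N) :
    Module.supportDim R N ≤ Module.supportDim R M := by
  rw [Module.supportDim_eq_ringKrullDim_quotient_annihilator,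
    Module.supportDim_eq_ringKrullDim_quotient_annihilator]
  exact ringKrullDim_le_of_surjective (Ideal.Quotient.factor h) (Ideal.Quotient.factor_surjective h)

theorem Module.length_ne_top_of_supportDim_le_zero [IsNoetherianRing R] {M : Type*} [AddCommGroup M]
    [Module R M] [Module.Finite R M] (h : Module.supportDim R M ≤ 0) : Module.length R M ≠ ⊤ := by
  rw [Module.supportDim_eq_ringKrullDim_quotient_annihilator] at h
  have h0 : Ring.KrullDimLE 0 (R ⧸ Module.annihilator R M) := by
    rw [Ring.krullDimLE_iff]; exact_mod_cast h
  have : IsArtinianRing (R ⧸ Module.annihilator R M) :=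
    isArtinianRing_iff_isNoetherianRing_krullDimLE_zero.mpr ⟨inferInstance, h0⟩
  let _ : Module (R ⧸ Module.annihilator R M) M := Module.quotientAnnihilator
  have : IsScalarTower R (R ⧸ Module.annihilator R M) M := ⟨fun r s m ↦ by
    obtain ⟨s, rfl⟩ := Ideal.Quotient.mk_surjective s
    exact mul_smul r s m⟩
  have : Module.Finite (R ⧸ Module.annihilator R M) M :=
    Module.Finite.of_restrictScalars_finite R _ _
  have : IsArtinian (R ⧸ Module.annihilator R M) M := inferInstance
  have : IsArtinian R M := isArtinian_of_surjective_algebraMap (R := R ⧸ Module.annihilator R M)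
    (S := R) Ideal.Quotient.mk_surjective
  exact Module.length_ne_top

/-- If `Hom(k, D)` has length at most one, then `Hom(N, D)` has length at most that of `N`. -/
theorem Module.length_linearMap_le {R : Type u} [CommRing R] [IsLocalRing R] {D : Type u}
    [AddCommGroup D] [Module R D]
    (hD : Module.length R (IsLocalRing.ResidueField R →ₗ[R] D) ≤ 1)
    {N : Type u} [AddCommGroup N] [Module R N] (hN : IsFiniteLength R N) :
    Module.length R (N →ₗ[R] D) ≤ Module.length R N := by
  induction hN with
  | of_subsingleton => rw [Module.length_eq_zero]; exact zero_le
  | @of_simple_quotient N _ _ S hS _ ih =>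
    have hadd : Module.length R N = Module.length R S + Module.length R (N ⧸ S) :=
      Module.length_eq_add_of_exact S.subtype S.mkQ (Submodule.subtype_injective _)
        (Submodule.mkQ_surjective _) (LinearMap.exact_subtype_mkQ S)
    have h1 : Module.length R ((N ⧸ S) →ₗ[R] D) ≤ 1 := by
      obtain ⟨m, hm, ⟨e⟩⟩ := isSimpleModule_iff_quot_maximal.mp hS
      obtain rfl := IsLocalRing.eq_maximalIdeal hm
      exact ((LinearEquiv.congrLeft D R e).length_eq).le.trans hD
    have hex : Function.Exact (S.mkQ.lcomp R D) (S.subtype.lcomp R D) := by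
      intro φ
      constructor
      · intro h
        refine ⟨S.liftQ φ fun x hx ↦ LinearMap.congr_fun h ⟨x, hx⟩, ?_⟩
        ext x; rfl
      · rintro ⟨ψ, rfl⟩
        ext x
        exact (congrArg ψ ((Submodule.Quotient.mk_eq_zero S).mpr x.2)).trans (map_zero ψ)
    refine (Module.length_le_add_of_exact hex).trans ?_
    rw [hadd, add_comm, Module.length_eq_one R (N ⧸ S)]
    exact add_le_add ih h1

/-- If `Hom(k, D)` has length at most one, then a module `D` killed by `I` has length at most that
of `R / I`, provided the latter is finite. -/
theorem Module.length_le_length_of_smul_eq_zero {R : Type u} [CommRing R] [IsLocalRing R]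
    {D : Type u} [AddCommGroup D] [Module R D]
    (hD : Module.length R (IsLocalRing.ResidueField R →ₗ[R] D) ≤ 1)
    {A : Type u} [AddCommGroup A] [Module R A] {π : R →ₗ[R] A} (hπ : Function.Surjective π)
    (hann : ∀ r, π r = 0 → ∀ w : D, r • w = 0) (hA : Module.length R A ≠ ⊤) :
    Module.length R D ≤ Module.length R A := by
  refine le_trans ?_ (Module.length_linearMap_le hD (Module.length_ne_top_iff.mp hA))
  -- `A` is `R / ker π` and `ker π` kills `D`, so any value at the generator `π 1` is attained by a
  -- homomorphism.
  refine Module.length_le_of_surjective (LinearMap.applyₗ (π 1)) fun d ↦ ?_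
  let φ := (LinearMap.ker π).liftQ (LinearMap.toSpanSingleton R D d) (fun r hr ↦ by
    simpa using hann r hr d)
  refine ⟨φ ∘ₗ (π.quotKerEquivOfSurjective hπ).symm.toLinearMap, ?_⟩
  have : (π.quotKerEquivOfSurjective hπ).symm (π 1) = Submodule.Quotient.mk 1 := by
    rw [LinearEquiv.symm_apply_eq]; rfl
  change φ ((π.quotKerEquivOfSurjective hπ).symm (π 1)) = d
  rw [this]
  exact one_smul R d

/-- If `π r = z • π s`, then `r - z * s` is in `ker π` and so kills `D`. This lets the hypothesis
"killed by the annihilator of the cyclic module" pass to quotients by `z`. -/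
theorem annihilator_quotSMulTop_le {A D : Type*} [AddCommGroup A] [Module R A] [AddCommGroup D]
    [Module R D] {π : R →ₗ[R] A} (hπ : Function.Surjective π)
    (hann : ∀ r, π r = 0 → ∀ w : D, r • w = 0) {z : R} {r : R}
    (hr : (Submodule.Quotient.mk (π r) : QuotSMulTop z A) = 0) :
    ∃ s : R, ∀ w : D, r • w = z • s • w := by
  rw [Submodule.Quotient.mk_eq_zero] at hr
  obtain ⟨a, -, ha⟩ := (Submodule.mem_smul_pointwise_iff_exists _ _ _).mp hr
  obtain ⟨s, rfl⟩ := hπ a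
  refine ⟨s, fun w ↦ ?_⟩
  have := hann (r - z * s) (by rw [map_sub, ← ha, ← smul_eq_mul, map_smul, sub_self]) w
  rwa [sub_smul, sub_eq_zero, mul_smul] at this

end Length

/-! ### The dimension of the cokernel of an embedding into a canonical module -/

section

variable {R : Type u} [CommRing R] [IsLocalRing R]

/-- The connecting map is injective because `Ext^n(k, W) = 0`. Hence the bound on the type survives
reduction modulo a regular element. -/
theorem length_ext_quotSMulTop_le {n : ℕ} {W : Type u} [AddCommGroup W] [Module R W] {y : R}
    (hy : IsSMulRegular W y) (hW : ExtResidueVanishes R W (n + 1)) :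
    Module.length R (Ext (ModuleCat.of R (IsLocalRing.ResidueField R))
      (ModuleCat.of R (QuotSMulTop y W)) n) ≤
    Module.length R (Ext (ModuleCat.of R (IsLocalRing.ResidueField R)) (ModuleCat.of R W) (n + 1)) := by
  have hS := ModuleCat.shortExact_of_linearMap (f := LinearMap.lsmul R W y) hy
    (LinearMap.exact_lsmul_mkQ_smul_top W y) (Submodule.mkQ_surjective _)
  let δ := (Ext.bilinearCompOfLinear R (ModuleCat.of R (IsLocalRing.ResidueField R))
    (ModuleCat.of R (QuotSMulTop y W)) (ModuleCat.of R W) n 1 (n + 1) rfl).flip hS.extClass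
  refine Module.length_le_of_injective δ ((injective_iff_map_eq_zero δ).mpr fun x hx ↦ ?_)
  obtain ⟨z, rfl⟩ := Ext.covariant_sequence_exact₃ _ hS x rfl hx
  rw [show z = 0 from (hW n n.lt_succ_self).elim _ _, Ext.zero_comp]

theorem length_linearMap_eq_length_ext_zero {R : Type u} [CommRing R] (N D : Type u)
    [AddCommGroup N] [Module R N] [AddCommGroup D] [Module R D] :
    Module.length R (N →ₗ[R] D) =
      Module.length R (Ext (ModuleCat.of R N) (ModuleCat.of R D) 0) :=
  ((Ext.linearEquiv₀ (R := R) (X := ModuleCat.of R N) (Y := ModuleCat.of R D)).trans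
    (ModuleCat.homLinearEquiv (S := R))).length_eq.symm

variable [IsNoetherianRing R]

/-- Additivity of length and the hypothesis `hAW` bound the length of `C / yⁿC` by that of the
kernel of `A / yⁿA → W / yⁿW`. By Artin–Rees this kernel lies in the image of `A / yᵏA` under `y ^
(n - k)`, so its length is bounded independently of `n`. -/
theorem exists_pow_quotSMulTop_length_le {R : Type u} [CommRing R] [IsNoetherianRing R]
    {A W C : Type u} [AddCommGroup A] [Module R A]
    [Module.Finite R A]
    [AddCommGroup W] [Module R W] [Module.Finite R W] [AddCommGroup C] [Module R C]
    {f : A →ₗ[R] W} {g : W →ₗ[R] C}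
    (hf : Function.Injective f) (hfg : Function.Exact f g) (hg : Function.Surjective g) {y : R}
    (hA : ∀ n, Module.length R (QuotSMulTop (y ^ n) A) ≠ ⊤)
    (hAW : ∀ n, Module.length R (QuotSMulTop (y ^ n) W) ≤ Module.length R (QuotSMulTop (y ^ n) A)) :
    ∃ L k : ℕ, ∀ n ≥ k, Module.length R (QuotSMulTop (y ^ n) C) ≤ L := by
  obtain ⟨k, hk⟩ := Ideal.exists_pow_inf_eq_pow_smul (Ideal.span {y}) (LinearMap.range f)
  refine ⟨(Module.length R (QuotSMulTop (y ^ k) A)).toNat, k, fun n hn ↦ ?_⟩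
  rw [ENat.natCast_toNat (hA k)]
  let f' := QuotSMulTop.map (y ^ n) f
  let g' := QuotSMulTop.map (y ^ n) g
  have e1 : Module.length R (QuotSMulTop (y ^ n) A) =
      Module.length R (LinearMap.ker f') + Module.length R (LinearMap.range f') :=
    Module.length_eq_add_of_exact (LinearMap.ker f').subtype f'.rangeRestrict
      (Submodule.subtype_injective _) f'.surjective_rangeRestrict
      (by rw [LinearMap.exact_iff]; simp)
  have e2 : Module.length R (QuotSMulTop (y ^ n) W) =
      Module.length R (LinearMap.range f') + Module.length R (QuotSMulTop (y ^ n) C) :=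
    Module.length_eq_add_of_exact (LinearMap.range f').subtype g'
      (Submodule.subtype_injective _) (QuotSMulTop.map_surjective _ hg)
      (by rw [LinearMap.exact_iff, (LinearMap.exact_iff.mp (QuotSMulTop.map_exact _ hfg hg))]; simp [f'])
  have hle := hAW n
  have htop := hA n
  have hr : Module.length R (LinearMap.range f') ≠ ⊤ := fun h ↦ htop (by rw [e1, h, add_top])
  have hker : Module.length R (QuotSMulTop (y ^ n) C) ≤ Module.length R (LinearMap.ker f') := by
    rw [e1, e2, add_comm] at hle
    exact (ENat.add_le_add_iff_right hr).mp hle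
  refine hker.trans ?_
  let m : QuotSMulTop (y ^ k) A →ₗ[R] QuotSMulTop (y ^ n) A :=
    Submodule.mapQ _ _ (LinearMap.lsmul R A (y ^ (n - k))) (by
      rintro x hx
      obtain ⟨z, -, rfl⟩ := (Submodule.mem_smul_pointwise_iff_exists _ _ _).mp hx
      refine (Submodule.mem_smul_pointwise_iff_exists _ _ _).mpr ⟨z, trivial, ?_⟩
      simp [smul_smul, ← pow_add, Nat.add_sub_cancel' hn])
  have hle : LinearMap.ker f' ≤ LinearMap.range m := by
    intro x hx
    obtain ⟨a, rfl⟩ := Submodule.Quotient.mk_surjective _ x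
    have hx : (Submodule.Quotient.mk (f a) : QuotSMulTop (y ^ n) W) = 0 := hx
    rw [Submodule.Quotient.mk_eq_zero] at hx
    have h1 : f a ∈ (Ideal.span {y} ^ n • (⊤ : Submodule R W)) ⊓ LinearMap.range f := by
      refine ⟨?_, a, rfl⟩
      rwa [Ideal.span_singleton_pow, Submodule.ideal_span_singleton_smul]
    rw [hk n hn, Ideal.span_singleton_pow, Submodule.ideal_span_singleton_smul] at h1
    obtain ⟨w, ⟨-, b, rfl⟩, hb⟩ := (Submodule.mem_smul_pointwise_iff_exists _ _ _).mp h1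
    rw [← map_smul] at hb
    exact ⟨Submodule.Quotient.mk b, congrArg _ (hf hb)⟩
  exact (Module.length_le_of_injective (Submodule.inclusion hle)
    (Submodule.inclusion_injective hle)).trans
      (Module.length_le_of_surjective m.rangeRestrict m.surjective_rangeRestrict)

theorem supportDim_quotSMulTop_le {A : Type u} [AddCommGroup A] [Module R A] [Module.Finite R A]
    {m : ℕ} {y : R} (hy : y ∈ IsLocalRing.maximalIdeal R) (hreg : IsSMulRegular A y)
    (h : Module.supportDim R A ≤ (m + 1 : ℕ)) : Module.supportDim R (QuotSMulTop y A) ≤ m := by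
  rw [← Module.supportDim_quotSMulTop_succ_eq_supportDim hreg hy, Nat.cast_add, Nat.cast_one] at h
  exact ENat.WithBot.add_le_add_one_right_iff.mp h

/-- The cokernel of an embedding of a cyclic module `A` of dimension at most `n + 1` into a module
of depth at least `n + 1` and type at most one over `R / Ann A` has dimension at most `n`. -/
theorem supportDim_cokernel_le (n : ℕ) {A W C : Type u} [AddCommGroup A] [Module R A]
    [AddCommGroup W] [Module R W] [Module.Finite R W] [AddCommGroup C] [Module R C]
    {f : A →ₗ[R] W} {g : W →ₗ[R] C}
    (hf : Function.Injective f) (hfg : Function.Exact f g) (hg : Function.Surjective g)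
    {π : R →ₗ[R] A} (hπ : Function.Surjective π) (hann : ∀ r, π r = 0 → ∀ w : W, r • w = 0)
    (hA : ExtResidueVanishes R A (n + 1)) (hW : ExtResidueVanishes R W (n + 1))
    (htype : Module.length R (Ext (ModuleCat.of R (IsLocalRing.ResidueField R))
      (ModuleCat.of R W) (n + 1)) ≤ 1)
    (hdim : Module.supportDim R A ≤ (n + 1 : ℕ)) : Module.supportDim R C ≤ n := by
  have hAfin : Module.Finite R A := Module.Finite.of_surjective π hπ
  have hCfin : Module.Finite R C := Module.Finite.of_surjective g hg
  induction n generalizing A W C with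
  | zero =>
    -- A regular element on the product is regular on each factor, which yields one `y` for both
    -- modules.
    obtain ⟨y, hy, hreg⟩ := IsLocalRing.exists_isSMulRegular (R := R) (M := A × W) (fun v hv ↦
      Prod.ext (hA.eq_zero_of_smul fun r hr ↦ congrArg Prod.fst (hv r hr))
        (hW.eq_zero_of_smul fun r hr ↦ congrArg Prod.snd (hv r hr)))
    have hyA : IsSMulRegular A y := fun a b h ↦
      congrArg Prod.fst (hreg (a₁ := (a, 0)) (a₂ := (b, 0)) (Prod.ext h rfl))
    have hyW : IsSMulRegular W y := fun a b h ↦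
      congrArg Prod.snd (hreg (a₁ := (0, a)) (a₂ := (0, b)) (Prod.ext rfl h))
    have hdimA : ∀ j, Module.supportDim R (QuotSMulTop (y ^ j) A) ≤ 0 := by
      intro j
      rcases j with _ | j
      · have : Subsingleton (QuotSMulTop (y ^ 0) A) := by
          rw [pow_zero, Submodule.Quotient.subsingleton_iff, one_smul]
        rw [Module.supportDim_eq_bot_of_subsingleton]; exact bot_le
      · exact_mod_cast supportDim_quotSMulTop_le (m := 0) (Ideal.pow_mem_of_mem _ hy _ j.succ_pos)
          (hyA.pow _) hdim
    obtain ⟨L, k, hL⟩ := exists_pow_quotSMulTop_length_le hf hfg hg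
      (fun j ↦ Module.length_ne_top_of_supportDim_le_zero (hdimA j)) (fun j ↦ by
        refine Module.length_le_length_of_smul_eq_zero ?_
          (π := (Submodule.mkQ _) ∘ₗ π) ((Submodule.mkQ_surjective _).comp hπ) ?_
          (Module.length_ne_top_of_supportDim_le_zero (hdimA j))
        · rw [length_linearMap_eq_length_ext_zero]
          exact (length_ext_quotSMulTop_le (hyW.pow j) hW).trans htype
        · intro r hr w
          obtain ⟨w, rfl⟩ := Submodule.Quotient.mk_surjective _ w
          obtain ⟨s, hs⟩ := annihilator_quotSMulTop_le hπ hann (z := y ^ j) hr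
          rw [← Submodule.Quotient.mk_smul, Submodule.Quotient.mk_eq_zero, hs]
          exact Submodule.smul_mem_pointwise_smul _ _ _ trivial)
    obtain ⟨j, -, hj⟩ := Submodule.exists_pow_smul_eq_bot_of_length_le (M := C) (L := L) (k := k)
      (I := Ideal.span {y}) ((Ideal.span_singleton_le_iff_mem _).mpr hy) (fun j hj ↦ by
        rw [Ideal.span_singleton_pow, Submodule.ideal_span_singleton_smul]; exact hL j hj)
    -- Now `yʲC = 0`. An element annihilating `A / yʲA` acts on `W` as a multiple of `yʲ`, hence
    -- kills `C`; so `C` has dimension at most that of `A / yʲA`.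
    refine le_trans (Module.supportDim_le_of_annihilator_le fun r hr ↦ ?_) (hdimA j)
    rw [Module.mem_annihilator] at hr ⊢
    obtain ⟨s, hs⟩ := annihilator_quotSMulTop_le hπ (D := W) hann (z := y ^ j) (r := r) (by
      have := hr (Submodule.Quotient.mk (π 1))
      rwa [← Submodule.Quotient.mk_smul, ← map_smul, smul_eq_mul, mul_one] at this)
    intro c
    obtain ⟨w, rfl⟩ := hg c
    rw [← map_smul, hs, map_smul, ← Submodule.mem_bot R, ← hj, Ideal.span_singleton_pow,
      Submodule.ideal_span_singleton_smul]
    exact Submodule.smul_mem_pointwise_smul _ _ _ trivial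
  | succ n ih =>
    -- Here `C` also has positive depth, so `y` can be chosen regular on it too; this keeps `A / yA
    -- → W / yW` injective. The ring stays `R`, which is why `A` is only assumed cyclic.
    have hC : ExtResidueVanishes R C 1 :=
      ((hA.of_exact hf hfg hg (hW.mono (by omega)))).mono (by omega)
    obtain ⟨y, hy, hreg⟩ := IsLocalRing.exists_isSMulRegular (R := R) (M := A × W × C) (fun v hv ↦
      Prod.ext ((hA.mono (by omega)).eq_zero_of_smul fun r hr ↦ congrArg Prod.fst (hv r hr))
        (Prod.ext ((hW.mono (by omega)).eq_zero_of_smul fun r hr ↦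
          congrArg (Prod.fst ∘ Prod.snd) (hv r hr))
        (hC.eq_zero_of_smul fun r hr ↦ congrArg (Prod.snd ∘ Prod.snd) (hv r hr))))
    have hyA : IsSMulRegular A y := fun a b h ↦
      congrArg Prod.fst (hreg (a₁ := (a, 0)) (a₂ := (b, 0)) (Prod.ext h rfl))
    have hyW : IsSMulRegular W y := fun a b h ↦
      congrArg (Prod.fst ∘ Prod.snd) (hreg (a₁ := (0, a, 0)) (a₂ := (0, b, 0))
        (Prod.ext rfl (Prod.ext h rfl)))
    have hyC : IsSMulRegular C y := fun a b h ↦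
      congrArg (Prod.snd ∘ Prod.snd) (hreg (a₁ := (0, 0, a)) (a₂ := (0, 0, b))
        (Prod.ext rfl (Prod.ext rfl h)))
    have := ih (f := QuotSMulTop.map y f) (g := QuotSMulTop.map y g) 
      ((injective_iff_map_eq_zero _).mpr fun a ha ↦ by
        obtain ⟨a, rfl⟩ := Submodule.Quotient.mk_surjective _ a
        have ha : (Submodule.Quotient.mk (f a) : QuotSMulTop y W) = 0 := ha
        rw [Submodule.Quotient.mk_eq_zero] at ha
        obtain ⟨w, -, hw⟩ := (Submodule.mem_smul_pointwise_iff_exists _ _ _).mp ha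
        have hgw : g w = 0 := hyC (by
          change y • g w = y • 0
          rw [← map_smul, hw, hfg.apply_apply_eq_zero, smul_zero])
        obtain ⟨b, rfl⟩ := (hfg w).mp hgw
        rw [Submodule.Quotient.mk_eq_zero, ← hf ((map_smul f y b).trans hw)]
        exact Submodule.smul_mem_pointwise_smul _ _ _ trivial)
      (QuotSMulTop.map_exact y hfg hg) (QuotSMulTop.map_surjective y hg)
      (π := (Submodule.mkQ _) ∘ₗ π) ((Submodule.mkQ_surjective _).comp hπ)
      (fun r hr w ↦ by
        obtain ⟨w, rfl⟩ := Submodule.Quotient.mk_surjective _ w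
        obtain ⟨s, hs⟩ := annihilator_quotSMulTop_le hπ hann (z := y) hr
        rw [← Submodule.Quotient.mk_smul, Submodule.Quotient.mk_eq_zero, hs]
        exact Submodule.smul_mem_pointwise_smul _ _ _ trivial)
      (hA.quotSMulTop hyA) (hW.quotSMulTop hyW) ((length_ext_quotSMulTop_le hyW hW).trans htype)
      (supportDim_quotSMulTop_le hy hyA hdim) inferInstance inferInstance
    refine (Module.supportDim_le_supportDim_quotSMulTop_succ hy).trans ?_
    push_cast
    gcongr

end

/-! ### Dimension shifting, and Ext under flat extension of the coefficients -/

section ExtSyzygy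

open scoped TensorProduct

variable {R : Type u} [CommRing R]

theorem subsingleton_ext_one_iff {K F X : Type u} [AddCommGroup K] [Module R K] [AddCommGroup F]
    [Module R F] [Module.Projective R F] [AddCommGroup X] [Module R X] {ι : K →ₗ[R] F}
    {p : F →ₗ[R] X} (hι : Function.Injective ι) (hιp : Function.Exact ι p)
    (hp : Function.Surjective p) (N : Type u) [AddCommGroup N] [Module R N] :
    Subsingleton (Ext (ModuleCat.of R X) (ModuleCat.of R N) 1) ↔
      ∀ φ : K →ₗ[R] N, ∃ ψ : F →ₗ[R] N, ψ ∘ₗ ι = φ := by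
  have hS := ModuleCat.shortExact_of_linearMap hι hιp hp
  have : Projective (ModuleCat.of R F) := (IsProjective.iff_projective F).mp inferInstance
  constructor
  · intro h φ
    obtain ⟨y, hy⟩ := Ext.contravariant_sequence_exact₁ hS _
      (Ext.mk₀ (ModuleCat.ofHom φ)) rfl (h.elim _ _)
    obtain ⟨ψ, rfl⟩ := Ext.mk₀_bijective _ _ |>.2 y
    rw [Ext.mk₀_comp_mk₀] at hy
    exact ⟨ψ.hom, congrArg ModuleCat.Hom.hom ((Ext.mk₀_bijective _ _).1 hy)⟩
  · intro h
    refine subsingleton_of_forall_eq 0 fun x ↦ ?_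
    obtain ⟨y, rfl⟩ := Ext.contravariant_sequence_exact₃ hS _ x
      (Ext.eq_zero_of_projective (P := ModuleCat.of R F) _) (n₀ := 0) rfl
    obtain ⟨φ, rfl⟩ := Ext.mk₀_bijective _ _ |>.2 y
    obtain ⟨ψ, hψ⟩ := h φ.hom
    have : φ = (ModuleCat.ofHom ι) ≫ ModuleCat.ofHom ψ := by
      rw [← ModuleCat.ofHom_comp, hψ]; rfl
    rw [this, ← Ext.mk₀_comp_mk₀]
    exact hS.extClass_comp_assoc _

theorem subsingleton_ext_succ_iff {K F X : Type u} [AddCommGroup K] [Module R K] [AddCommGroup F]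
    [Module R F] [Module.Projective R F] [AddCommGroup X] [Module R X] {ι : K →ₗ[R] F}
    {p : F →ₗ[R] X} (hι : Function.Injective ι) (hιp : Function.Exact ι p)
    (hp : Function.Surjective p) (N : Type u) [AddCommGroup N] [Module R N] (i : ℕ) :
    Subsingleton (Ext (ModuleCat.of R X) (ModuleCat.of R N) (i + 2)) ↔
      Subsingleton (Ext (ModuleCat.of R K) (ModuleCat.of R N) (i + 1)) := by
  have hS := ModuleCat.shortExact_of_linearMap hι hιp hp
  have : Projective (ModuleCat.of R F) := (IsProjective.iff_projective F).mp inferInstance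
  constructor
  · intro h
    refine subsingleton_of_forall_eq 0 fun x ↦ ?_
    obtain ⟨y, rfl⟩ := Ext.contravariant_sequence_exact₁ hS _ x (n₁ := i + 2) (by omega)
      (h.elim _ _)
    rw [Ext.eq_zero_of_projective (P := ModuleCat.of R F) y, Ext.comp_zero]
  · intro h
    refine subsingleton_of_forall_eq 0 fun x ↦ ?_
    obtain ⟨y, rfl⟩ := Ext.contravariant_sequence_exact₃ hS _ x
      (Ext.eq_zero_of_projective (P := ModuleCat.of R F) _) (n₀ := i + 1) (by omega)
    rw [show y = 0 from h.elim _ _, Ext.comp_zero]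

variable [IsNoetherianRing R] {S S' : Type u} [CommRing S] [Algebra R S] [CommRing S'] [Algebra R S']
  [Algebra S S'] [IsScalarTower R S S'] {C : Type u} [AddCommGroup C] [Module S C] [Module R C]
  [IsScalarTower R S C]

/-- For finitely presented `K`, `Hom_R(K, S' ⊗ C) = S' ⊗ Hom_R(K, C)`: the homomorphisms are the
kernel of the relation matrix `ρ : C^a → C^b`, and flatness of `S'` over `S` preserves kernels. Thus
`φ` is a finite sum of terms `s ⊗ φ'`, and each `φ'` extends to `F`. No flatness over `R` is
involved. -/
theorem TensorProduct.exists_extension_of_flat [Module.Flat S S'] {K F : Type u} [AddCommGroup K]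
    [Module R K] [Module.Finite R K] [AddCommGroup F] [Module R F] {ι : K →ₗ[R] F}
    (h : ∀ φ : K →ₗ[R] C, ∃ ψ : F →ₗ[R] C, ψ ∘ₗ ι = φ) (φ : K →ₗ[R] S' ⊗[S] C) :
    ∃ ψ : F →ₗ[R] S' ⊗[S] C, ψ ∘ₗ ι = φ := by
  obtain ⟨a, π, hπ⟩ := Module.Finite.exists_fin' R K
  obtain ⟨b, α, hα⟩ := Module.Finite.exists_fin' R (LinearMap.ker π)
  let α' : Fin b → Fin a → R := fun i ↦ (α (Pi.single i 1) : Fin a → R)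
  have hkill : ∀ {N : Type u} [AddCommGroup N] [Module R N] (κ : Fin a → N),
      (∀ i, ∑ j, α' i j • κ j = 0) → ∃ φ : K →ₗ[R] N, ∀ j, φ (π (Pi.single j 1)) = κ j := by
    intro N _ _ κ hκ
    let c := Fintype.linearCombination R κ
    have hc : LinearMap.ker π ≤ LinearMap.ker c := by
      intro x hx
      obtain ⟨y, hy⟩ := hα ⟨x, hx⟩
      have h0 : c ∘ₗ (LinearMap.ker π).subtype ∘ₗ α = 0 := by
        refine (Pi.basisFun R (Fin b)).ext fun i ↦ ?_
        simpa [c, Fintype.linearCombination_apply, α'] using hκ i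
      have := LinearMap.congr_fun h0 y
      simpa [hy] using this
    refine ⟨(LinearMap.ker π).liftQ c hc ∘ₗ (π.quotKerEquivOfSurjective hπ).symm.toLinearMap,
      fun j ↦ ?_⟩
    have : (π.quotKerEquivOfSurjective hπ).symm (π (Pi.single j 1)) =
        Submodule.Quotient.mk (Pi.single j 1) := by
      rw [LinearEquiv.symm_apply_eq]; rfl
    simp [this, c]
  let ρ : (Fin a → C) →ₗ[S] (Fin b → C) := LinearMap.pi fun i ↦
    ∑ j, algebraMap R S (α' i j) • LinearMap.proj j
  let e := TensorProduct.piRight S S S' (fun _ : Fin a ↦ C)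
  let e' := TensorProduct.piRight S S S' (fun _ : Fin b ↦ C)
  let t : Fin a → S' ⊗[S] C := fun j ↦ φ (π (Pi.single j 1))
  have hρ : ∀ (u : S' ⊗[S] (Fin a → C)) (i : Fin b),
      e' (ρ.lTensor S' u) i = ∑ j, α' i j • e u j := by
    intro u i
    induction u with
    | zero => simp
    | add x y hx hy => simp [hx, hy, Finset.sum_add_distrib]
    | tmul s c =>
      simp [e, e', ρ, TensorProduct.tmul_sum]
  have ht : ∀ i, ∑ j, α' i j • t j = 0 := by
    intro i
    have h0 : φ (π (α' i)) = 0 := (congrArg φ (α (Pi.single i 1)).2).trans (map_zero φ)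
    have hsum : α' i = ∑ j, α' i j • (Pi.single j 1 : Fin a → R) := by
      conv_lhs => rw [pi_eq_sum_univ' (α' i)]
    rw [hsum, map_sum, map_sum] at h0
    simpa only [map_smul] using h0
  have hex := Module.Flat.lTensor_exact S' (LinearMap.exact_subtype_ker_map ρ)
  obtain ⟨z, hz⟩ := (hex (e.symm t)).mp (e'.injective (funext fun i ↦ by
    rw [hρ, map_zero]; simpa using ht i))
  have key : ∀ z : S' ⊗[S] (LinearMap.ker ρ), ∃ ψ : F →ₗ[R] S' ⊗[S] C,
      ∀ j, ψ (ι (π (Pi.single j 1))) = e ((LinearMap.ker ρ).subtype.lTensor S' z) j := by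
    intro z
    induction z with
    | zero => exact ⟨0, by simp⟩
    | add x y hx hy =>
      obtain ⟨ψ₁, h₁⟩ := hx
      obtain ⟨ψ₂, h₂⟩ := hy
      exact ⟨ψ₁ + ψ₂, fun j ↦ by simp [h₁, h₂]⟩
    | tmul s κ =>
      obtain ⟨φ, hφ⟩ := hkill κ.1 (fun i ↦ by
        simpa [ρ] using congrFun κ.2 i)
      obtain ⟨ψ, rfl⟩ := h φ
      refine ⟨((TensorProduct.mk S S' C s).restrictScalars R) ∘ₗ ψ, fun j ↦ ?_⟩
      have := hφ j
      simp only [LinearMap.comp_apply] at this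
      simp [this, e]
  obtain ⟨ψ, hψ⟩ := key z
  refine ⟨ψ, ?_⟩
  have : (ψ ∘ₗ ι) ∘ₗ π = φ ∘ₗ π := by
    refine (Pi.basisFun R (Fin a)).ext fun j ↦ ?_
    simpa [hz, t] using hψ j
  exact LinearMap.ext fun x ↦ by
    obtain ⟨x, rfl⟩ := hπ x
    exact LinearMap.congr_fun this x

theorem subsingleton_ext_tensorProduct [Module.Flat S S'] (i : ℕ) {M : Type u} [AddCommGroup M]
    [Module R M] [Module.Finite R M]
    (h : Subsingleton (Ext (ModuleCat.of R M) (ModuleCat.of R C) (i + 1))) :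
    Subsingleton (Ext (ModuleCat.of R M) (ModuleCat.of R (S' ⊗[S] C)) (i + 1)) := by
  obtain ⟨a, π, hπ⟩ := Module.Finite.exists_fin' R M
  induction i generalizing M a with
  | zero =>
    rw [zero_add, subsingleton_ext_one_iff (Submodule.subtype_injective _)
      (LinearMap.exact_subtype_ker_map π) hπ] at h ⊢
    exact TensorProduct.exists_extension_of_flat h
  | succ i ih =>
    rw [subsingleton_ext_succ_iff (Submodule.subtype_injective _)
      (LinearMap.exact_subtype_ker_map π) hπ] at h ⊢
    obtain ⟨b, π', hπ'⟩ := Module.Finite.exists_fin' R (LinearMap.ker π)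
    exact ih h b π' hπ'

end ExtSyzygy

/-! ### McCoy's argument for filtered modules -/

section Superficial

variable {S : Type*} [CommRing S]

/-- In a finitely generated module over a Noetherian ring, no element of `Iʲ C` outside `Iʲ⁺¹ C`
is multiplied by `I` into `Iʲ⁺² C`, once `j` is large. -/
theorem Ideal.exists_mem_pow_smul_of_smul_mem [IsNoetherianRing S] (I : Ideal S) (C : Type*)
    [AddCommGroup C] [Module S C] [Module.Finite S C] :
    ∃ c, ∀ j ≥ c, ∀ v ∈ I ^ j • (⊤ : Submodule S C),
      (∀ a ∈ I, a • v ∈ I ^ (j + 2) • (⊤ : Submodule S C)) →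
      v ∈ I ^ (j + 1) • (⊤ : Submodule S C) := by
  have hstep : ∀ (j : ℕ) {a : S} {v : C}, a ∈ I → v ∈ I ^ j • (⊤ : Submodule S C) →
      a • v ∈ I ^ (j + 1) • (⊤ : Submodule S C) := fun j a v ha hv ↦ by
    rw [pow_succ', Submodule.mul_smul]
    exact Submodule.smul_mem_smul ha hv
  -- `Z j` consists of the elements whose classes in degree `j` of the associated graded module are
  -- killed by all degree-one forms. As a subfiltration of a stable one it is stable (Artin–Rees),
  -- so eventually `Z (j + 1) = I • Z j`, which lies in `I ^ (j + 2) • ⊤` by definition.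
  let Z : I.Filtration C :=
    { N := fun j ↦
        { carrier := {v | v ∈ I ^ j • (⊤ : Submodule S C) ∧
            ∀ a ∈ I, a • v ∈ I ^ (j + 2) • (⊤ : Submodule S C)}
          zero_mem' := ⟨zero_mem _, fun a _ ↦ by rw [smul_zero]; exact zero_mem _⟩
          add_mem' := fun hx hy ↦ ⟨add_mem hx.1 hy.1, fun a ha ↦ by
            rw [smul_add]; exact add_mem (hx.2 a ha) (hy.2 a ha)⟩
          smul_mem' := fun r x hx ↦ ⟨Submodule.smul_mem _ r hx.1, fun a ha ↦ by
            rw [smul_comm]; exact Submodule.smul_mem _ r (hx.2 a ha)⟩ }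
      mono := fun j v hv ↦ ⟨Submodule.pow_smul_top_le I C j.le_succ hv.1, fun a ha ↦
        hstep (j + 1) ha hv.1⟩
      smul_le := fun j ↦ Submodule.smul_le.mpr fun r hr v hv ↦ ⟨hstep j hr hv.1, fun a ha ↦
        hstep (j + 2) ha (hv.2 r hr)⟩ }
  have hle : Z ≤ I.stableFiltration ⊤ := fun j v hv ↦ hv.1
  obtain ⟨n, hn⟩ := (I.stableFiltration_stable (⊤ : Submodule S C)).of_le hle
  refine ⟨n + 1, fun j hj v hv h ↦ ?_⟩
  obtain ⟨j, rfl⟩ : ∃ i, j = i + 1 := ⟨j - 1, by omega⟩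
  have hZ : v ∈ Z.N (j + 1) := ⟨hv, h⟩
  rw [← hn j (by omega)] at hZ
  have hw : ∀ w ∈ Z.N j, ∀ r ∈ I, r • w ∈ I ^ (j + 2) • (⊤ : Submodule S C) := fun w hw ↦ hw.2
  exact Submodule.smul_le.mpr (fun r hr w h ↦ hw w h r hr) hZ

/-- The coefficients of the product of `∑ i < q, a i * X ^ i` and `∑ l, c l * X ^ l`. -/
def mulCoeff {C : Type*} [AddCommGroup C] [Module S C] (a : ℕ → S) (q : ℕ) (c : ℕ → C) (l : ℕ) : C :=
  ∑ i ∈ Finset.range q, if i ≤ l then a i • c (l - i) else 0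

variable {C : Type*} [AddCommGroup C] [Module S C]

theorem mulCoeff_smul (a : ℕ → S) (q : ℕ) (c : ℕ → C) (b : S) (l : ℕ) :
    mulCoeff a q (b • c) l = b • mulCoeff a q c l := by
  rw [mulCoeff, mulCoeff, Finset.smul_sum]
  refine Finset.sum_congr rfl fun i _ ↦ ?_
  split_ifs
  · exact smul_comm _ _ _
  · rw [smul_zero]

theorem mulCoeff_succ (a : ℕ → S) (q : ℕ) (c : ℕ → C) (l : ℕ) :
    mulCoeff a (q + 1) c l = mulCoeff a q c l + if q ≤ l then a q • c (l - q) else 0 :=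
  Finset.sum_range_succ _ _

/-- McCoy's theorem read in the graded pieces `V j / V (j + 1)`: if a polynomial with degree-one
coefficients `a i` kills a nonzero polynomial with coefficients `c l`, then some `b` of degree `k`
keeps `c` nonzero while every `a i` kills `b • c`. -/
theorem exists_smul_mem_of_mulCoeff_mem (V : ℕ → Submodule S C) (a : ℕ → S) :
    ∀ (q : ℕ), (∀ i < q, ∀ j, ∀ v ∈ V j, a i • v ∈ V (j + 1)) → ∀ (j : ℕ) (c : ℕ → C) (N : ℕ),
    (∀ l ≥ N, c l = 0) → (∀ l, c l ∈ V j) → (∀ l, mulCoeff a q c l ∈ V (j + 2)) →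
    (∃ l, c l ∉ V (j + 1)) →
    ∃ (b : S) (k : ℕ), (∀ i, ∀ v ∈ V i, b • v ∈ V (i + k)) ∧ (∃ l, b • c l ∉ V (j + k + 1)) ∧
      ∀ i < q, ∀ l, a i • b • c l ∈ V (j + k + 2)
  | 0, _, j, c, N, _, _, _, hc => ⟨1, 0, by simp, by simpa using hc, by simp⟩
  | q + 1, ha, j, c, N, hN, hcj, hmul, hc => by
    have hpow : ∀ p i, ∀ v ∈ V i, a q ^ p • v ∈ V (i + p) := by
      intro p
      induction p with
      | zero => simp
      | succ p ih =>
        intro i v hv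
        rw [pow_succ', mul_smul]
        exact ha q q.lt_succ_self _ _ (ih i v hv)
    -- The product's coefficient at `l + q` equals `a q • c l` plus terms with `c` at indices beyond
    -- `l`, so each further power of `a q` kills one more coefficient from the top.
    have htop : ∀ p l, N ≤ l + p → a q ^ p • c l ∈ V (j + p + 1) := by
      intro p
      induction p with
      | zero => intro l hl; rw [hN l hl, smul_zero]; exact zero_mem _
      | succ p ih =>
        intro l hl
        have h1 := hpow p _ _ (hmul (l + q))
        rw [mulCoeff_succ, if_pos (Nat.le_add_left q l), Nat.add_sub_cancel, smul_add, smul_smul,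
          ← pow_succ] at h1
        have h2 : a q ^ p • mulCoeff a q c (l + q) ∈ V (j + p + 2) := by
          rw [mulCoeff, Finset.smul_sum]
          refine Submodule.sum_mem _ fun i hi ↦ ?_
          rw [Finset.mem_range] at hi
          rw [if_pos (by omega), smul_comm]
          exact ha i (by omega) _ _ (ih _ (by omega))
        rw [show j + 2 + p = j + p + 2 by omega] at h1
        exact (Submodule.add_mem_iff_right _ h2).mp h1
    have hex : ∃ p, ∀ l, a q ^ p • c l ∈ V (j + p + 1) := ⟨N, fun l ↦ htop N l (by omega)⟩
    classical
    -- With `p + 1` the least exponent killing `c`, the polynomial `a q ^ p • c` is nonzero and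
    -- killed by `a q`. The remaining `q` coefficients then kill it as a polynomial, and the
    -- recursion applies.
    obtain ⟨p, hp⟩ : ∃ p, Nat.find hex = p + 1 := by
      refine Nat.exists_eq_succ_of_ne_zero fun h0 ↦ ?_
      have := Nat.find_spec hex
      rw [h0] at this
      obtain ⟨l, hl⟩ := hc
      exact hl (by simpa using this l)
    have hp1 : ∀ l, a q ^ (p + 1) • c l ∈ V (j + (p + 1) + 1) := hp ▸ Nat.find_spec hex
    have hp2 : ¬ ∀ l, a q ^ p • c l ∈ V (j + p + 1) := Nat.find_min hex (by omega)
    push Not at hp2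
    obtain ⟨b, k, hb, hne, hall⟩ := exists_smul_mem_of_mulCoeff_mem V a q
      (fun i hi ↦ ha i (by omega)) (j + p) (a q ^ p • c) N
      (fun l hl ↦ by rw [Pi.smul_apply, hN l hl, smul_zero]) (fun l ↦ hpow p _ _ (hcj l))
      (fun l ↦ by
        have h1 := hpow p _ _ (hmul l)
        rw [← mulCoeff_smul, mulCoeff_succ, show j + 2 + p = j + p + 2 by omega] at h1
        refine (Submodule.add_mem_iff_left _ ?_).mp h1
        split_ifs
        · rw [Pi.smul_apply, smul_smul, ← pow_succ']
          exact hp1 _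
        · exact zero_mem _) hp2
    refine ⟨b * a q ^ p, p + k, fun i v hv ↦ ?_, ?_, fun i hi l ↦ ?_⟩
    · rw [mul_smul, ← add_assoc]
      exact hb _ _ (hpow p i v hv)
    · simpa only [mul_smul, ← add_assoc] using! hne
    · rcases Nat.lt_succ_iff_lt_or_eq.mp hi with hi | rfl
      · simpa only [mul_smul, ← add_assoc] using! hall i hi l
      · have := hb _ _ (hp1 l)
        rw [mul_smul, smul_comm, smul_smul (a i), ← pow_succ']
        convert! this using 2
        omega

theorem mem_of_mulCoeff_mem (V : ℕ → Submodule S C) (a : ℕ → S) (q : ℕ)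
    (ha : ∀ i < q, ∀ j, ∀ v ∈ V j, a i • v ∈ V (j + 1))
    (hV : ∀ j, ∀ v ∈ V j, (∀ i < q, a i • v ∈ V (j + 2)) → v ∈ V (j + 1)) (j : ℕ) (c : ℕ → C) (N : ℕ)
    (hN : ∀ l ≥ N, c l = 0) (hc : ∀ l, c l ∈ V j) (hmul : ∀ l, mulCoeff a q c l ∈ V (j + 2)) (l : ℕ) :
    c l ∈ V (j + 1) := by
  by_contra hl
  obtain ⟨b, k, hb, ⟨l, hne⟩, hall⟩ :=
    exists_smul_mem_of_mulCoeff_mem V a q ha j c N hN hc hmul ⟨l, hl⟩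
  exact hne (hV _ _ (hb _ _ (hc l)) fun i hi ↦ hall i hi l)

end Superficial

/-! ### Tensors over the generic extension as polynomials in `ξ` -/

section GenericExtension

open scoped TensorProduct Polynomial

section PolyTensor

variable {S : Type u} [CommRing S] {S' : Type u} [CommRing S'] [Algebra S S']
  {C : Type u} [AddCommGroup C] [Module S C]


/-- The element `∑ l < N, ξ ^ l ⊗ c l`. -/
noncomputable def polyTensor (S : Type u) [CommRing S] {S' : Type u} [CommRing S'] [Algebra S S']
    {C : Type u} [AddCommGroup C] [Module S C] (ξ : S') (N : ℕ) (c : ℕ → C) : S' ⊗[S] C :=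
  ∑ l ∈ Finset.range N, (ξ ^ l) ⊗ₜ[S] c l

variable {ξ : S'}

theorem polyTensor_mem_baseChange {U : Submodule S C} (N : ℕ) {c : ℕ → C} (hc : ∀ l, c l ∈ U) :
    polyTensor S ξ N c ∈ U.baseChange S' :=
  Submodule.sum_mem _ fun l _ ↦ by
    simpa [TensorProduct.smul_tmul'] using
      Submodule.smul_mem _ (ξ ^ l) (Submodule.tmul_mem_baseChange_of_mem (1 : S') (hc l))

theorem polyTensor_eq_of_le {N N' : ℕ} {c : ℕ → C} (hc : ∀ l ≥ N, c l = 0) (h : N ≤ N') :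
    polyTensor S ξ N' c = polyTensor S ξ N c :=
  (Finset.sum_subset (Finset.range_mono h) fun l _ hl ↦ by
    rw [hc l (by simpa using hl), TensorProduct.tmul_zero]).symm

theorem pow_smul_polyTensor (i N : ℕ) (c : ℕ → C) :
    ξ ^ i • polyTensor S ξ N c = polyTensor S ξ (N + i) fun l ↦ if i ≤ l then c (l - i) else 0 := by
  rw [polyTensor, polyTensor, Finset.smul_sum, add_comm N, Finset.sum_range_add]
  rw [Finset.sum_eq_zero (s := Finset.range i) fun l hl ↦ ?_, zero_add]
  · refine Finset.sum_congr rfl fun l _ ↦ ?_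
    rw [if_pos (Nat.le_add_right _ _), Nat.add_sub_cancel_left, TensorProduct.smul_tmul', pow_add,
      smul_eq_mul]
  · rw [if_neg (by simpa using hl), TensorProduct.tmul_zero]

theorem smul_polyTensor_eq_mulCoeff (a : ℕ → S) (q N : ℕ) {c : ℕ → C} (hc : ∀ l ≥ N, c l = 0) :
    (∑ i ∈ Finset.range q, algebraMap S S' (a i) * ξ ^ i) • polyTensor S ξ N c =
      polyTensor S ξ (N + q) (mulCoeff a q c) := by
  have h : ∀ i ∈ Finset.range q, (algebraMap S S' (a i) * ξ ^ i) • polyTensor S ξ N c =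
      ∑ l ∈ Finset.range (N + q), (ξ ^ l) ⊗ₜ[S] (if i ≤ l then a i • c (l - i) else 0) := by
    intro i hi
    rw [mul_smul, pow_smul_polyTensor, ← polyTensor_eq_of_le (N' := N + q) _ (by
      have := Finset.mem_range.mp hi; omega), polyTensor, Finset.smul_sum]
    · refine Finset.sum_congr rfl fun l _ ↦ ?_
      rw [algebraMap_smul, ← TensorProduct.tmul_smul, smul_ite, smul_zero]
    · intro l hl
      rw [if_pos (by omega), hc _ (by omega)]
  rw [Finset.sum_smul, Finset.sum_congr rfl h, Finset.sum_comm, polyTensor]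
  refine Finset.sum_congr rfl fun l _ ↦ ?_
  rw [mulCoeff, TensorProduct.tmul_sum]

theorem exists_aeval_smul_polyTensor {U : Submodule S C} (f : S[X]) (N : ℕ) {c : ℕ → C}
    (hc : ∀ l ≥ N, c l = 0) (hU : ∀ l, c l ∈ U) :
    ∃ (N' : ℕ) (c' : ℕ → C), (∀ l ≥ N', c' l = 0) ∧ (∀ l, c' l ∈ U) ∧
      Polynomial.aeval ξ f • polyTensor S ξ N c = polyTensor S ξ N' c' := by
  refine ⟨N + (f.natDegree + 1), mulCoeff f.coeff (f.natDegree + 1) c, fun l hl ↦ ?_, fun l ↦ ?_, ?_⟩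
  · refine Finset.sum_eq_zero fun i hi ↦ ?_
    have := Finset.mem_range.mp hi
    rw [if_pos (by omega), hc _ (by omega), smul_zero]
  · refine Submodule.sum_mem _ fun i _ ↦ ?_
    split_ifs
    · exact Submodule.smul_mem _ _ (hU _)
    · exact zero_mem _
  · rw [← smul_polyTensor_eq_mulCoeff _ _ _ hc, Polynomial.aeval_eq_sum_range]
    simp only [Algebra.smul_def]

end PolyTensor

/-- `S'` behaves like the localization of `S[X]` at `𝔪 S[X]`, with `ξ` in the role of `X`. -/
structure IsGenericExtension (S : Type*) [CommRing S] [IsLocalRing S] {S' : Type*} [CommRing S']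
    [IsLocalRing S'] [Algebra S S'] (ξ : S') : Prop where
  flat : Module.Flat S S'
  map_maximalIdeal : (IsLocalRing.maximalIdeal S).map (algebraMap S S') = IsLocalRing.maximalIdeal S'
  coeff_mem : ∀ f : S[X], Polynomial.aeval ξ f ∈ IsLocalRing.maximalIdeal S' →
    ∀ i, f.coeff i ∈ IsLocalRing.maximalIdeal S
  exists_mul_eq : ∀ s : S', ∃ g : S[X], IsUnit (Polynomial.aeval ξ g) ∧
    ∃ f : S[X], Polynomial.aeval ξ g * s = Polynomial.aeval ξ f

variable {S : Type u} [CommRing S] [IsLocalRing S] {S' : Type u} [CommRing S'] [IsLocalRing S']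
  [Algebra S S']

theorem Submodule.baseChange_pow_maximalIdeal_smul_top
    (h : (IsLocalRing.maximalIdeal S).map (algebraMap S S') = IsLocalRing.maximalIdeal S')
    (C : Type*) [AddCommGroup C] [Module S C] (n : ℕ) :
    (IsLocalRing.maximalIdeal S ^ n • (⊤ : Submodule S C)).baseChange S' =
      IsLocalRing.maximalIdeal S' ^ n • (⊤ : Submodule S' (S' ⊗[S] C)) := by
  rw [← h, ← Ideal.map_pow]
  generalize IsLocalRing.maximalIdeal S ^ n = I
  refine le_antisymm ?_ ?_
  · rw [Submodule.baseChange_eq_span, Submodule.span_le]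
    rintro _ ⟨c, hc, rfl⟩
    change (1 : S') ⊗ₜ[S] c ∈ _
    refine Submodule.smul_induction_on hc (fun r hr n _ ↦ ?_) fun x y hx hy ↦ ?_
    · rw [← TensorProduct.smul_tmul, Algebra.smul_def, ← smul_eq_mul, ← TensorProduct.smul_tmul']
      exact Submodule.smul_mem_smul (Ideal.mem_map_of_mem _ hr) trivial
    · rw [TensorProduct.tmul_add]
      exact add_mem hx hy
  · refine Submodule.smul_le.mpr fun r hr z _ ↦ ?_
    induction hr using Submodule.span_induction with
    | mem x hx =>
      obtain ⟨a, ha, rfl⟩ := hx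
      induction z with
      | zero => rw [smul_zero]; exact zero_mem _
      | add x y hx hy => rw [smul_add]; exact add_mem (hx trivial) (hy trivial)
      | tmul s c =>
        have := Submodule.smul_mem _ s (Submodule.tmul_mem_baseChange_of_mem (1 : S')
          (Submodule.smul_mem_smul ha (Submodule.mem_top (x := c))))
        rw [TensorProduct.smul_tmul', smul_eq_mul, mul_one] at this
        rwa [algebraMap_smul, ← TensorProduct.tmul_smul]
    | zero => rw [zero_smul]; exact zero_mem _
    | add x y _ _ hx hy => rw [add_smul]; exact add_mem hx hy
    | smul t x _ hx => rw [smul_assoc]; exact Submodule.smul_mem _ t hx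

variable {C : Type u} [AddCommGroup C] [Module S C] {ξ : S'}

namespace IsGenericExtension

/-- Clearing denominators: a unit multiple of any tensor is a polynomial in `ξ` with coefficients in
`U`. -/
theorem exists_isUnit_smul_eq_polyTensor (h : IsGenericExtension S ξ) {U : Submodule S C}
    {z : S' ⊗[S] C} (hz : z ∈ U.baseChange S') :
    ∃ g : S[X], IsUnit (Polynomial.aeval ξ g) ∧ ∃ (N : ℕ) (c : ℕ → C), (∀ l ≥ N, c l = 0) ∧
      (∀ l, c l ∈ U) ∧ Polynomial.aeval ξ g • z = polyTensor S ξ N c := by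
  rw [Submodule.baseChange_eq_span] at hz
  induction hz using Submodule.span_induction with
  | mem x hx =>
    obtain ⟨c, hc, rfl⟩ := hx
    refine ⟨1, by simp, 1, fun l ↦ if l = 0 then c else 0, fun l hl ↦ if_neg (by omega),
      fun l ↦ ?_, by simp [polyTensor]⟩
    dsimp only
    split_ifs
    exacts [hc, zero_mem _]
  | zero => exact ⟨1, by simp, 0, 0, by simp, by simp, by simp [polyTensor]⟩
  | smul s x _ hx =>
    obtain ⟨w, hw, N, c, hN, hU, hx⟩ := hx
    obtain ⟨w', hw', f, hf⟩ := h.exists_mul_eq s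
    obtain ⟨N', c', hN', hU', he⟩ := exists_aeval_smul_polyTensor (ξ := ξ) f N hN hU
    refine ⟨w' * w, by rw [map_mul]; exact hw'.mul hw, N', c', hN', hU', ?_⟩
    rw [← he, ← hx, ← hf, smul_smul, smul_smul, map_mul]
    congr 1; ring
  | add x y _ _ hx hy =>
    obtain ⟨w, hw, N, c, hN, hU, hx⟩ := hx
    obtain ⟨v, hv, M, d, hM, hV, hy⟩ := hy
    obtain ⟨N', c', hN', hU', he⟩ := exists_aeval_smul_polyTensor (ξ := ξ) v N hN hU
    obtain ⟨M', d', hM', hV', he'⟩ := exists_aeval_smul_polyTensor (ξ := ξ) w M hM hV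
    refine ⟨w * v, by rw [map_mul]; exact hw.mul hv, max N' M', c' + d', fun l hl ↦ ?_,
      fun l ↦ add_mem (hU' l) (hV' l), ?_⟩
    · rw [Pi.add_apply, hN' l (le_of_max_le_left hl), hM' l (le_of_max_le_right hl), add_zero]
    · have hadd : polyTensor S ξ (max N' M') (c' + d') =
          polyTensor S ξ (max N' M') c' + polyTensor S ξ (max N' M') d' := by
        simp only [polyTensor, Pi.add_apply, TensorProduct.tmul_add, Finset.sum_add_distrib]
      rw [hadd, polyTensor_eq_of_le hN' (le_max_left _ _), polyTensor_eq_of_le hM' (le_max_right _ _),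
        ← he, ← he', ← hx, ← hy, smul_smul, smul_smul, map_mul, smul_add, mul_comm]

/-- The powers of `ξ` are linearly independent over the residue field of `S`. A functional on `U /
𝔪U` turns the tensor into a polynomial in `ξ` vanishing in the residue field of `S'`, so all its
coefficients vanish; functionals separate the points of `U / 𝔪U`. -/
theorem mem_of_polyTensor_mem_baseChange (h : IsGenericExtension S ξ) {U : Submodule S C} (N : ℕ)
    {c : ℕ → C} (hc : ∀ l, c l ∈ U)
    (hmem : polyTensor S ξ N c ∈ (IsLocalRing.maximalIdeal S • U).baseChange S') {l : ℕ}
    (hl : l < N) : c l ∈ IsLocalRing.maximalIdeal S • U := by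
  have := h.flat
  have : IsLocalHom (algebraMap S S') :=
    ((IsLocalRing.local_hom_TFAE (algebraMap S S')).out 2 0).mp h.map_maximalIdeal.le
  let c' : ℕ → U := fun l ↦ ⟨c l, hc l⟩
  let V := IsLocalRing.maximalIdeal S • U
  have hVU : V ≤ U := Submodule.smul_le_right
  obtain ⟨v, hv⟩ := hmem
  have hv' : (Submodule.inclusion hVU).lTensor S' v = polyTensor S ξ N c' := by
    refine Module.Flat.lTensor_preserves_injective_linearMap (M := S') U.subtype
      (Submodule.subtype_injective _) ?_
    rw [← LinearMap.comp_apply, ← LinearMap.lTensor_comp, Submodule.subtype_comp_inclusion]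
    refine hv.trans ?_
    simp [polyTensor, c']
  let Q := U ⧸ (IsLocalRing.maximalIdeal S • (⊤ : Submodule S U))
  let _ : Module (IsLocalRing.ResidueField S) Q :=
    Module.instQuotientIdealSubmoduleHSMulTop U (IsLocalRing.maximalIdeal S)
  have hmap : ∀ x : U, x ∈ IsLocalRing.maximalIdeal S • (⊤ : Submodule S U) ↔ (x : C) ∈ V := by
    intro x
    have hmt : (IsLocalRing.maximalIdeal S • (⊤ : Submodule S U)).map U.subtype = V := by
      rw [Submodule.map_smul'', Submodule.map_subtype_top]
    rw [← hmt]
    exact ⟨fun hx ↦ ⟨x, hx, rfl⟩, fun ⟨y, hy, he⟩ ↦ Subtype.ext he ▸ hy⟩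
  change (c' l : C) ∈ V
  rw [← hmap, ← Submodule.Quotient.mk_eq_zero,
    ← Module.forall_dual_apply_eq_zero_iff (IsLocalRing.ResidueField S) (V := Q)]
  intro f
  let f' : U →ₗ[S] IsLocalRing.ResidueField S :=
    { toFun := fun x ↦ f (Submodule.Quotient.mk x)
      map_add' := fun x y ↦ by rw [Submodule.Quotient.mk_add, map_add]
      map_smul' := fun r x ↦ by
        rw [Submodule.Quotient.mk_smul]
        exact f.map_smul (Ideal.Quotient.mk _ r) (Submodule.Quotient.mk x) }
  let μ : S' ⊗[S] IsLocalRing.ResidueField S →ₗ[S] IsLocalRing.ResidueField S' :=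
    TensorProduct.lift ((LinearMap.mul S (IsLocalRing.ResidueField S')).compl₁₂
      (IsScalarTower.toAlgHom S S' (IsLocalRing.ResidueField S')).toLinearMap
      (IsScalarTower.toAlgHom S (IsLocalRing.ResidueField S)
        (IsLocalRing.ResidueField S')).toLinearMap)
  have hzero : f'.lTensor S' (polyTensor S ξ N c') = 0 := by
    rw [← hv', ← LinearMap.comp_apply, ← LinearMap.lTensor_comp]
    have : f' ∘ₗ Submodule.inclusion hVU = 0 := by
      ext x
      have hx := (Submodule.Quotient.mk_eq_zero _).mpr ((hmap (Submodule.inclusion hVU x)).mpr x.2)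
      exact (congrArg f hx).trans (map_zero f)
    rw [this, LinearMap.lTensor_zero, LinearMap.zero_apply]
  choose s hs using fun l ↦ Ideal.Quotient.mk_surjective (f' (c' l))
  have hμ := congrArg μ hzero
  let p : S[X] := ∑ l ∈ Finset.range N, Polynomial.monomial l (s l)
  have hp : algebraMap S' (IsLocalRing.ResidueField S') (Polynomial.aeval ξ p) = 0 := by
    rw [map_zero] at hμ
    rw [← hμ]
    simp only [p, polyTensor, map_sum, LinearMap.lTensor_tmul]
    refine Finset.sum_congr rfl fun l _ ↦ ?_
    rw [Polynomial.aeval_monomial, map_mul, mul_comm, ← IsScalarTower.algebraMap_apply,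
      IsScalarTower.algebraMap_apply S (IsLocalRing.ResidueField S)]
    exact congrArg _ (congrArg _ (hs l))
  have hpl := h.coeff_mem p (Ideal.Quotient.eq_zero_iff_mem.mp hp) l
  have : p.coeff l = s l := by
    simp [p, Polynomial.coeff_monomial, hl]
  rw [this] at hpl
  exact (hs l).symm.trans (Ideal.Quotient.eq_zero_iff_mem.mpr hpl)

end IsGenericExtension

end GenericExtension

/-! ### The generic superficial element -/

section GenericElement

open scoped TensorProduct Polynomial

variable {S : Type u} [CommRing S] [IsLocalRing S] {S' : Type u} [CommRing S'] [IsLocalRing S']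
  [Algebra S S'] {ξ : S'}

namespace IsGenericExtension

theorem exists_mem_of_smul_mem [IsNoetherianRing S] (h : IsGenericExtension S ξ) {C : Type u}
    [AddCommGroup C] [Module S C]
    [Module.Finite S C] (a : ℕ → S) (q : ℕ)
    (ha : Ideal.span (a '' {i | i < q}) = IsLocalRing.maximalIdeal S) :
    ∃ c, ∀ j ≥ c, ∀ z ∈ IsLocalRing.maximalIdeal S' ^ j • (⊤ : Submodule S' (S' ⊗[S] C)),
      (∑ i ∈ Finset.range q, algebraMap S S' (a i) * ξ ^ i) • z ∈
        IsLocalRing.maximalIdeal S' ^ (j + 2) • (⊤ : Submodule S' (S' ⊗[S] C)) →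
      z ∈ IsLocalRing.maximalIdeal S' ^ (j + 1) • (⊤ : Submodule S' (S' ⊗[S] C)) := by
  obtain ⟨n, hn⟩ := Ideal.exists_mem_pow_smul_of_smul_mem (IsLocalRing.maximalIdeal S) C
  have hbc := Submodule.baseChange_pow_maximalIdeal_smul_top h.map_maximalIdeal C
  have hai : ∀ i < q, a i ∈ IsLocalRing.maximalIdeal S := fun i hi ↦
    ha ▸ Ideal.subset_span ⟨i, hi, rfl⟩
  have hmul : ∀ i < q, ∀ j, ∀ v ∈ IsLocalRing.maximalIdeal S ^ j • (⊤ : Submodule S C),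
      a i • v ∈ IsLocalRing.maximalIdeal S ^ (j + 1) • (⊤ : Submodule S C) := by
    intro i hi j v hv
    rw [pow_succ', Submodule.mul_smul]
    exact Submodule.smul_mem_smul (hai i hi) hv
  refine ⟨n, fun j hj z hz hyz ↦ ?_⟩
  rw [← hbc] at hz hyz ⊢
  obtain ⟨g, hg, N, c, hN, hc, hgz⟩ := h.exists_isUnit_smul_eq_polyTensor hz
  have hzero : ∀ l ≥ N + q, mulCoeff a q c l = 0 := fun l hl ↦ by
    refine Finset.sum_eq_zero fun i hi ↦ ?_
    have := Finset.mem_range.mp hi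
    rw [if_pos (by omega), hN _ (by omega), smul_zero]
  have hY : ∀ l, mulCoeff a q c l ∈ IsLocalRing.maximalIdeal S ^ (j + 2) • (⊤ : Submodule S C) := by
    have h1 : polyTensor S ξ (N + q) (mulCoeff a q c) ∈
        (IsLocalRing.maximalIdeal S ^ (j + 2) • (⊤ : Submodule S C)).baseChange S' := by
      rw [← smul_polyTensor_eq_mulCoeff a q N hN, ← hgz, smul_comm]
      exact Submodule.smul_mem _ _ hyz
    rw [show j + 2 = j + 1 + 1 from rfl, pow_succ', Submodule.mul_smul] at h1 ⊢
    intro l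
    by_cases hl : l < N + q
    · refine h.mem_of_polyTensor_mem_baseChange (N + q) (fun l ↦ ?_) h1 hl
      refine Submodule.sum_mem _ fun i hi ↦ ?_
      split_ifs
      · exact hmul i (Finset.mem_range.mp hi) j _ (hc _)
      · exact zero_mem _
    · rw [hzero l (not_lt.mp hl)]
      exact zero_mem _
  -- The filtration is shifted by `n` so that the condition on elements killed by degree-one forms
  -- holds at every index.
  have hc' := mem_of_mulCoeff_mem
    (fun i ↦ IsLocalRing.maximalIdeal S ^ (n + i) • (⊤ : Submodule S C)) a q
    (fun i hi k v hv ↦ hmul i hi (n + k) v hv) (fun k v hv hav ↦ by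
      refine hn (n + k) (by omega) v hv fun r hr ↦ ?_
      rw [← ha] at hr
      induction hr using Submodule.span_induction with
      | mem x hx => obtain ⟨i, hi, rfl⟩ := hx; exact hav i hi
      | zero => rw [zero_smul]; exact zero_mem _
      | add x y _ _ hx hy => rw [add_smul]; exact add_mem hx hy
      | smul t x _ hx => rw [smul_assoc]; exact Submodule.smul_mem _ t hx)
    (j - n) c N hN
    (fun l ↦ by rw [show n + (j - n) = j by omega]; exact hc l)
    (fun l ↦ by rw [show n + (j - n + 2) = j + 2 by omega]; exact hY l)
  rw [show n + (j - n + 1) = j + 1 by omega] at hc'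
  have := polyTensor_mem_baseChange (ξ := ξ) N hc'
  rw [← hgz] at this
  obtain ⟨u, hu⟩ := hg
  rw [← hu] at this
  simpa [← Units.smul_def] using Submodule.smul_mem _ (↑u⁻¹ : S') this

/-- A generic linear combination of generators of `𝔪` is a superficial nonzerodivisor on a
module of positive depth. -/
theorem exists_superficial [IsNoetherianRing S] [IsNoetherianRing S'] (h : IsGenericExtension S ξ)
    {C : Type u} [AddCommGroup C] [Module S C] [Module.Finite S C] {x : S}
    (hx : x ∈ IsLocalRing.maximalIdeal S) (hxreg : IsSMulRegular C x) :
    ∃ y ∈ IsLocalRing.maximalIdeal S', IsSMulRegular (S' ⊗[S] C) y ∧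
      ∃ n₀, ∀ n ≥ n₀, ∀ z : S' ⊗[S] C,
        y • z ∈ IsLocalRing.maximalIdeal S' ^ (n + 1) • (⊤ : Submodule S' (S' ⊗[S] C)) →
        z ∈ IsLocalRing.maximalIdeal S' ^ n • (⊤ : Submodule S' (S' ⊗[S] C)) := by
  obtain ⟨q, a, ha⟩ : ∃ (q : ℕ) (a : ℕ → S),
      Ideal.span (a '' {i | i < q}) = IsLocalRing.maximalIdeal S := by
    obtain ⟨q, b, hb⟩ := Submodule.fg_iff_exists_fin_generating_family.mp
      (IsNoetherian.noetherian (IsLocalRing.maximalIdeal S))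
    refine ⟨q, fun i ↦ if hi : i < q then b ⟨i, hi⟩ else 0, ?_⟩
    rw [← hb]
    congr 1
    ext s
    constructor
    · rintro ⟨i, hi, rfl⟩
      have hi' : i < q := hi
      exact ⟨⟨i, hi'⟩, by simp [hi']⟩
    · rintro ⟨i, rfl⟩
      exact ⟨i, i.2, dif_pos i.2⟩
  obtain ⟨c, hc⟩ := h.exists_mem_of_smul_mem (C := C) a q ha
  set y := ∑ i ∈ Finset.range q, algebraMap S S' (a i) * ξ ^ i with hy
  have hflat := h.flat
  have hym : y ∈ IsLocalRing.maximalIdeal S' := by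
    refine Ideal.sum_mem _ fun i hi ↦ Ideal.mul_mem_right _ _ ?_
    rw [← h.map_maximalIdeal]
    exact Ideal.mem_map_of_mem _ (ha ▸ Ideal.subset_span ⟨i, Finset.mem_range.mp hi, rfl⟩)
  have hiter : ∀ n (z : S' ⊗[S] C),
      z ∈ IsLocalRing.maximalIdeal S' ^ c • (⊤ : Submodule S' (S' ⊗[S] C)) →
      y • z ∈ IsLocalRing.maximalIdeal S' ^ (n + 1) • (⊤ : Submodule S' (S' ⊗[S] C)) →
      c ≤ n → z ∈ IsLocalRing.maximalIdeal S' ^ n • (⊤ : Submodule S' (S' ⊗[S] C)) := by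
    intro n z hz hyz hcn
    suffices ∀ j ≥ c, j ≤ n →
      z ∈ IsLocalRing.maximalIdeal S' ^ j • (⊤ : Submodule S' (S' ⊗[S] C)) from this n hcn le_rfl
    intro j hj
    induction j, hj using Nat.le_induction with
    | base => exact fun _ ↦ hz
    | succ j hj ih =>
      intro hjn
      exact hc j hj z (ih (by omega)) (Submodule.pow_smul_top_le _ _ (by omega) hyz)
  -- If `y • z = 0`, then `x ^ c • z` is deep enough for `hiter`, which pushes it into every power;
  -- Krull's intersection theorem makes it zero, and `x` is regular.
  have hreg : IsSMulRegular (S' ⊗[S] C) y := by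
    suffices hinj : ∀ z : S' ⊗[S] C, y • z = 0 → z = 0 from fun z₁ z₂ he ↦
      sub_eq_zero.mp (hinj _ (by rw [smul_sub]; exact sub_eq_zero.mpr he))
    intro z hz
    have hx' : IsSMulRegular (S' ⊗[S] C) (algebraMap S S' x) :=
      hxreg.of_flat_of_isBaseChange (TensorProduct.isBaseChange S C S')
    have hxz : algebraMap S S' x ^ c • z = 0 := by
      have hmem : algebraMap S S' x ^ c • z ∈
          IsLocalRing.maximalIdeal S' ^ c • (⊤ : Submodule S' (S' ⊗[S] C)) :=
        Submodule.smul_mem_smul (Ideal.pow_mem_pow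
          (h.map_maximalIdeal ▸ Ideal.mem_map_of_mem _ hx) c) trivial
      have hall : algebraMap S S' x ^ c • z ∈
          (⨅ i, IsLocalRing.maximalIdeal S' ^ i • (⊤ : Submodule S' (S' ⊗[S] C))) := by
        rw [Submodule.mem_iInf]
        intro i
        refine Submodule.pow_smul_top_le _ _ (le_max_left i c) (hiter _ _ hmem ?_ (le_max_right i c))
        rw [smul_comm, hz, smul_zero]
        exact zero_mem _
      rwa [Ideal.iInf_pow_smul_eq_bot_of_isLocalRing _ (Ideal.IsPrime.ne_top'),
        Submodule.mem_bot] at hall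
    exact (hx'.pow c) (hxz.trans (smul_zero _).symm)
  refine ⟨y, hym, hreg, ?_⟩
  -- Artin–Rees supplies the starting depth for `hiter`: `y • z = y • z'` with `z'` in the power `n
  -- + 1 - k ≥ c`, and `z = z'` by regularity.
  obtain ⟨k, hk⟩ := Ideal.exists_pow_inf_eq_pow_smul (IsLocalRing.maximalIdeal S')
    (LinearMap.range (LinearMap.lsmul S' (S' ⊗[S] C) y))
  refine ⟨c + k, fun n hn z hz ↦ hiter n z ?_ hz (by omega)⟩
  have h1 : y • z ∈ IsLocalRing.maximalIdeal S' ^ (n + 1) • (⊤ : Submodule S' (S' ⊗[S] C)) ⊓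
    LinearMap.range (LinearMap.lsmul S' (S' ⊗[S] C) y) := ⟨hz, z, rfl⟩
  rw [hk _ (by omega)] at h1
  have h2 : y • z ∈ IsLocalRing.maximalIdeal S' ^ (n + 1 - k) •
      (⊤ : Submodule S' (S' ⊗[S] C)).map (LinearMap.lsmul S' (S' ⊗[S] C) y) := by
    refine Submodule.smul_mono le_rfl ?_ h1
    rw [Submodule.map_top]
    exact inf_le_right
  rw [← Submodule.map_smul''] at h2
  obtain ⟨z', hz', he⟩ := h2
  rw [← hreg he]
  exact Submodule.pow_smul_top_le _ _ (by omega) hz'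

end IsGenericExtension

theorem exists_isGenericExtension (S : Type u) [CommRing S] [IsLocalRing S] [IsNoetherianRing S] :
    ∃ (S' : Type u) (_ : CommRing S') (_ : IsLocalRing S') (_ : IsNoetherianRing S')
      (_ : Algebra S S') (ξ : S'), IsGenericExtension S ξ := by
  let P : Ideal S[X] := (IsLocalRing.maximalIdeal S).map (Polynomial.C : S →+* S[X])
  let S' := Localization.AtPrime P
  have hN : IsNoetherianRing S' := IsLocalization.isNoetherianRing P.primeCompl S' inferInstance
  have haeval : ∀ f : S[X], Polynomial.aeval (algebraMap S[X] S' Polynomial.X) f =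
      algebraMap S[X] S' f := fun f ↦ by
    rw [Polynomial.aeval_algebraMap_apply, Polynomial.aeval_X_left_apply]
  refine ⟨S', inferInstance, inferInstance, hN, inferInstance, algebraMap S[X] S' Polynomial.X, ?_⟩
  refine ⟨?_, ?_, fun f hf i ↦ ?_, fun s ↦ ?_⟩
  · have : Module.Flat S[X] S' := IsLocalization.flat S' P.primeCompl
    exact Module.Flat.trans S S[X] S'
  · rw [IsScalarTower.algebraMap_eq S S[X] S', ← Ideal.map_map]
    exact Localization.AtPrime.map_eq_maximalIdeal
  · rw [haeval, IsLocalization.AtPrime.to_map_mem_maximal_iff S' P] at hf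
    exact Ideal.mem_map_C_iff.mp hf i
  · obtain ⟨f, g, rfl⟩ := IsLocalization.exists_mk'_eq P.primeCompl s
    refine ⟨g, ?_, f, ?_⟩
    · rw [haeval]; exact IsLocalization.map_units S' g
    · rw [haeval, haeval, IsLocalization.mk'_spec']

end GenericElement

/-! ### Hilbert–Samuel functions modulo a superficial element -/

section Hilbert

open scoped TensorProduct

/-- The Hilbert–Samuel function of `C` with respect to the maximal ideal. -/
noncomputable def hilbertSamuel (S : Type*) [CommRing S] [IsLocalRing S] (C : Type*) [AddCommGroup C]
    [Module S C] (j : ℕ) : ℕ :=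
  (Module.length S (C ⧸ (IsLocalRing.maximalIdeal S ^ j • (⊤ : Submodule S C)))).toNat

section

variable {S : Type*} [CommRing S] [IsLocalRing S]

variable {S' : Type*} [CommRing S'] [IsLocalRing S'] [Algebra S S']

theorem hilbertSamuel_baseChange [Module.Flat S S']
    (h : (IsLocalRing.maximalIdeal S).map (algebraMap S S') = IsLocalRing.maximalIdeal S')
    (C : Type*) [AddCommGroup C] [Module S C] (j : ℕ) :
    hilbertSamuel S' (S' ⊗[S] C) j = hilbertSamuel S C j := by
  have : IsLocalHom (algebraMap S S') :=
    ((IsLocalRing.local_hom_TFAE (algebraMap S S')).out 2 0).mp h.le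
  have hk : Module.length S' (S' ⧸ IsLocalRing.maximalIdeal S') = 1 :=
    Module.length_eq_one_iff.mpr
      ((isSimpleModule_iff_quot_maximal).mpr ⟨_, inferInstance, ⟨LinearEquiv.refl _ _⟩⟩)
  rw [hilbertSamuel, hilbertSamuel, ← h, ← Ideal.map_pow,
    (TensorProduct.tensorQuotMapSMulEquivTensorQuot C S' _).length_eq,
    IsLocalRing.length_baseChange, h, hk, mul_one]

theorem hilbertSamuel_quotSMulTop_one {C : Type*} [AddCommGroup C] [Module S C] {y : S}
    (hy : y ∈ IsLocalRing.maximalIdeal S) :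
    hilbertSamuel S (QuotSMulTop y C) 1 = hilbertSamuel S C 1 := by
  let e : (C ⧸ (IsLocalRing.maximalIdeal S ^ 1 • (⊤ : Submodule S C))) ≃ₗ[S]
      (QuotSMulTop y C ⧸ (IsLocalRing.maximalIdeal S ^ 1 • (⊤ : Submodule S (QuotSMulTop y C)))) := by
    refine LinearEquiv.ofBijective (Submodule.mapQ _ _ (Submodule.mkQ _) ?_) ⟨?_, ?_⟩
    · rw [← Submodule.map_le_iff_le_comap, Submodule.map_smul'']
      exact Submodule.smul_mono le_rfl le_top
    · rw [injective_iff_map_eq_zero]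
      intro z hz
      obtain ⟨z, rfl⟩ := Submodule.Quotient.mk_surjective _ z
      have hz : (Submodule.mkQ (y • (⊤ : Submodule S C))) z ∈
        IsLocalRing.maximalIdeal S ^ 1 • (⊤ : Submodule S (QuotSMulTop y C)) :=
        (Submodule.Quotient.mk_eq_zero _).mp hz
      rw [← Submodule.range_mkQ, ← Submodule.map_top, ← Submodule.map_smul''] at hz
      obtain ⟨z', hz', he⟩ := hz
      rw [Submodule.Quotient.mk_eq_zero]
      have h1 : z - z' ∈ y • (⊤ : Submodule S C) := (Submodule.Quotient.eq _).mp he.symm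
      have h2 : z - z' ∈ IsLocalRing.maximalIdeal S ^ 1 • (⊤ : Submodule S C) := by
        obtain ⟨w, -, hw⟩ := (Submodule.mem_smul_pointwise_iff_exists _ _ _).mp h1
        rw [← hw, pow_one]
        exact Submodule.smul_mem_smul hy trivial
      simpa using add_mem h2 hz'
    · exact fun z ↦ by
        obtain ⟨z, rfl⟩ := Submodule.Quotient.mk_surjective _ z
        obtain ⟨z, rfl⟩ := Submodule.Quotient.mk_surjective _ z
        exact ⟨Submodule.Quotient.mk z, rfl⟩
  rw [hilbertSamuel, hilbertSamuel, e.length_eq]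

variable [IsNoetherianRing S]

theorem length_quotient_pow_maximalIdeal_ne_top (C : Type*) [AddCommGroup C] [Module S C]
    [Module.Finite S C] (j : ℕ) :
    Module.length S (C ⧸ (IsLocalRing.maximalIdeal S ^ j • (⊤ : Submodule S C))) ≠ ⊤ := by
  refine Module.length_ne_top_of_supportDim_le_zero ?_
  rw [Module.supportDim_eq_ringKrullDim_quotient_annihilator]
  set I := Module.annihilator S (C ⧸ (IsLocalRing.maximalIdeal S ^ j • (⊤ : Submodule S C)))
  have hle : IsLocalRing.maximalIdeal S ^ j ≤ I := by
    intro r hr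
    rw [Module.mem_annihilator]
    intro c
    obtain ⟨c, rfl⟩ := Submodule.Quotient.mk_surjective _ c
    rw [← Submodule.Quotient.mk_smul, Submodule.Quotient.mk_eq_zero]
    exact Submodule.smul_mem_smul hr trivial
  have : Ring.KrullDimLE 0 (S ⧸ I) := .mk₀ fun P hP ↦ by
    have hPc : (P.comap (Ideal.Quotient.mk I)).IsPrime := Ideal.IsPrime.comap _
    have h1 : IsLocalRing.maximalIdeal S ≤ P.comap (Ideal.Quotient.mk I) :=
      hPc.le_of_pow_le (n := j) fun r hr ↦ by
        rw [Ideal.mem_comap, Ideal.Quotient.eq_zero_iff_mem.mpr (hle hr)]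
        exact zero_mem _
    have h2 : (P.comap (Ideal.Quotient.mk I)).IsMaximal := by
      rw [← (IsLocalRing.maximalIdeal.isMaximal S).eq_of_le hPc.ne_top h1]
      exact IsLocalRing.maximalIdeal.isMaximal S
    have h3 := Ideal.map_comap_of_surjective _ (Ideal.Quotient.mk_surjective (I := I)) P
    rcases Ideal.map_eq_top_or_isMaximal_of_surjective _ (Ideal.Quotient.mk_surjective (I := I)) h2
      with h4 | h4
    · exact absurd (h3.symm.trans h4) hP.ne_top
    · exact h3 ▸ h4
  exact_mod_cast (Ring.krullDimLE_iff.mp this)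

theorem coe_hilbertSamuel (C : Type*) [AddCommGroup C] [Module S C] [Module.Finite S C] (j : ℕ) :
    (hilbertSamuel S C j : ℕ∞) =
      Module.length S (C ⧸ (IsLocalRing.maximalIdeal S ^ j • (⊤ : Submodule S C))) :=
  ENat.natCast_toNat (length_quotient_pow_maximalIdeal_ne_top C j)

theorem hilbertSamuel_mono (C : Type*) [AddCommGroup C] [Module S C] [Module.Finite S C] :
    Monotone (hilbertSamuel S C) := fun i j hij ↦ by
  rw [← Nat.cast_le (α := ℕ∞), coe_hilbertSamuel, coe_hilbertSamuel]
  exact Module.length_le_of_surjective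
    (Submodule.factor (Submodule.pow_smul_top_le _ _ hij)) (Submodule.factor_surjective _)

variable {C : Type*} [AddCommGroup C] [Module S C] [Module.Finite S C]

/-- The colon condition `h` is injectivity of multiplication by `y` from `C / 𝔪ʲC` to `C / 𝔪ʲ⁺¹C`,
whose cokernel is the corresponding quotient of `C / yC`. -/
theorem hilbertSamuel_succ_eq_add {y : S} (hy : y ∈ IsLocalRing.maximalIdeal S) {j : ℕ}
    (h : ∀ z : C, y • z ∈ IsLocalRing.maximalIdeal S ^ (j + 1) • (⊤ : Submodule S C) →
      z ∈ IsLocalRing.maximalIdeal S ^ j • (⊤ : Submodule S C)) :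
    hilbertSamuel S C (j + 1) = hilbertSamuel S C j + hilbertSamuel S (QuotSMulTop y C) (j + 1) := by
  rw [← Nat.cast_inj (R := ℕ∞), Nat.cast_add, coe_hilbertSamuel, coe_hilbertSamuel, coe_hilbertSamuel]
  let f : (C ⧸ (IsLocalRing.maximalIdeal S ^ j • (⊤ : Submodule S C))) →ₗ[S]
      (C ⧸ (IsLocalRing.maximalIdeal S ^ (j + 1) • (⊤ : Submodule S C))) :=
    Submodule.mapQ _ _ (LinearMap.lsmul S C y) fun z hz ↦ by
      rw [pow_succ', Submodule.mul_smul]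
      exact Submodule.smul_mem_smul hy hz
  let g : (C ⧸ (IsLocalRing.maximalIdeal S ^ (j + 1) • (⊤ : Submodule S C))) →ₗ[S]
      (QuotSMulTop y C ⧸ (IsLocalRing.maximalIdeal S ^ (j + 1) •
        (⊤ : Submodule S (QuotSMulTop y C)))) :=
    Submodule.mapQ _ _ (Submodule.mkQ _) (by
      rw [← Submodule.map_le_iff_le_comap, Submodule.map_smul'']
      exact Submodule.smul_mono le_rfl le_top)
  refine Module.length_eq_add_of_exact f g ?_ ?_ ?_
  · rw [injective_iff_map_eq_zero]
    intro z hz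
    obtain ⟨z, rfl⟩ := Submodule.Quotient.mk_surjective _ z
    exact (Submodule.Quotient.mk_eq_zero _).mpr (h z ((Submodule.Quotient.mk_eq_zero _).mp hz))
  · exact fun z ↦ by
      obtain ⟨z, rfl⟩ := Submodule.Quotient.mk_surjective _ z
      obtain ⟨z, rfl⟩ := Submodule.Quotient.mk_surjective _ z
      exact ⟨Submodule.Quotient.mk z, rfl⟩
  · intro z
    obtain ⟨z, rfl⟩ := Submodule.Quotient.mk_surjective _ z
    constructor
    · intro hz
      have hz : (Submodule.mkQ (y • (⊤ : Submodule S C))) z ∈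
        IsLocalRing.maximalIdeal S ^ (j + 1) • (⊤ : Submodule S (QuotSMulTop y C)) :=
        (Submodule.Quotient.mk_eq_zero _).mp hz
      rw [← Submodule.range_mkQ, ← Submodule.map_top, ← Submodule.map_smul''] at hz
      obtain ⟨z', hz', he⟩ := hz
      have h1 : z - z' ∈ y • (⊤ : Submodule S C) := (Submodule.Quotient.eq _).mp he.symm
      obtain ⟨w, -, hw⟩ := (Submodule.mem_smul_pointwise_iff_exists _ _ _).mp h1
      refine ⟨Submodule.Quotient.mk w, (Submodule.Quotient.eq _).mpr ?_⟩
      change y • w - z ∈ _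
      rw [hw, sub_sub_cancel_left]
      exact neg_mem hz'
    · rintro ⟨w, hw⟩
      obtain ⟨w, rfl⟩ := Submodule.Quotient.mk_surjective _ w
      rw [← hw]
      refine (Submodule.Quotient.mk_eq_zero _).mpr ?_
      have : (Submodule.mkQ (y • (⊤ : Submodule S C))) (y • w) = 0 :=
        (Submodule.Quotient.mk_eq_zero _).mpr (Submodule.smul_mem_pointwise_smul _ _ _ trivial)
      exact this ▸ zero_mem _

end

section Growth

variable {f g : ℕ → ℕ} {n₀ : ℕ}

/-- Monotonicity gives `t * g N ≤ f (N + t)`. Taking `t = N + 1` and dividing by `N + 1` lowers the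
degree of the bound by one. -/
theorem exists_le_mul_pow_of_succ_eq_add (hg : Monotone g)
    (h : ∀ j ≥ n₀, f (j + 1) = f j + g (j + 1)) {B s : ℕ} (hf : ∀ j, f j ≤ B * (j + 1) ^ (s + 1)) :
    ∃ B', ∀ j, g j ≤ B' * (j + 1) ^ s := by
  have hsum : ∀ t N, n₀ ≤ N → t * g N ≤ f (N + t) := by
    intro t N hN
    induction t with
    | zero => simp
    | succ t ih =>
      rw [← add_assoc, h _ (by omega), add_mul, one_mul]
      exact add_le_add ih (hg (by omega))
  have hlarge : ∀ N ≥ n₀, g N ≤ B * 2 ^ (s + 1) * (N + 1) ^ s := by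
    intro N hN
    have h1 := (hsum (N + 1) N hN).trans (hf _)
    have h2 : B * (N + (N + 1) + 1) ^ (s + 1) = (N + 1) * (B * 2 ^ (s + 1) * (N + 1) ^ s) := by
      rw [show N + (N + 1) + 1 = 2 * (N + 1) by ring, mul_pow]; ring
    rw [h2] at h1
    exact Nat.le_of_mul_le_mul_left h1 N.succ_pos
  refine ⟨B * 2 ^ (s + 1) * (n₀ + 1) ^ s, fun j ↦ ?_⟩
  rcases le_total n₀ j with hj | hj
  · refine (hlarge j hj).trans (Nat.mul_le_mul_right _ (Nat.le_mul_of_pos_right _ (by positivity)))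
  · exact ((hg hj).trans (hlarge n₀ le_rfl)).trans (Nat.le_mul_of_pos_right _ (by positivity))

/-- Summation of the lower bound for `g` by Pascal's rule. -/
theorem exists_mul_choose_le_of_succ_eq_add (hg : Monotone g)
    (h : ∀ j ≥ n₀, f (j + 1) = f j + g (j + 1)) {L c s : ℕ} (hL : ∀ j, L * j.choose s ≤ g (j + c)) :
    ∃ c', ∀ j, L * j.choose (s + 1) ≤ f (j + c') := by
  refine ⟨max n₀ c, fun j ↦ ?_⟩
  induction j with
  | zero => simp
  | succ j ih =>
    rw [add_right_comm, h _ (by omega), Nat.choose_succ_succ, mul_add, add_comm]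
    exact add_le_add ih ((hL j).trans (hg (by omega)))

end Growth

theorem subsingleton_ext_quotient_smul_top {R S : Type u} [CommRing R] [CommRing S] [Algebra R S]
    {E : Type u} [AddCommGroup E] [Module S E] [Module R E] [IsScalarTower R S E] {y : S}
    (hy : IsSMulRegular E y) (X : ModuleCat.{u} R) (i : ℕ)
    (h : Subsingleton (Ext X (ModuleCat.of R E) i))
    (h' : Subsingleton (Ext X (ModuleCat.of R E) (i + 1))) {N : Submodule S E}
    (hN : N = y • ⊤) :
    Subsingleton (Ext X (ModuleCat.of R (E ⧸ N)) i) := by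
  let f : E →ₗ[R] E := (LinearMap.lsmul S E y).restrictScalars R
  let g : E →ₗ[R] E ⧸ N := N.mkQ.restrictScalars R
  have hfg : Function.Exact f g := by subst hN; exact LinearMap.exact_lsmul_mkQ_smul_top E y
  have hg : Function.Surjective g := Submodule.mkQ_surjective _
  exact subsingleton_ext_of_exact_covariant (f := f) hy hfg hg X i h h'

/-- If `C` has depth at least `s` and its Hilbert–Samuel function grows at most like `j ^ s`, then
it grows at least like `L * choose j s` for some `L` not less than the number of generators, and in
the case of equality the vanishing of `Ext(M, C)` passes to a nonzero module killed by the maximal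
ideal. -/
theorem exists_hilbertSamuel_bound {R : Type u} [CommRing R] [IsLocalRing R] [IsNoetherianRing R]
    {M : Type u} [AddCommGroup M] [Module R M] [Module.Finite R M] {n : ℕ} (hn : 0 < n) :
    ∀ (s : ℕ) (S : Type u) [CommRing S] [IsLocalRing S] [IsNoetherianRing S] [Algebra R S]
    [IsLocalHom (algebraMap R S)] (C : Type u) [AddCommGroup C] [Module S C] [Module R C]
    [IsScalarTower R S C] [Module.Finite S C] [Nontrivial C],
    ExtResidueVanishes S C s → (∃ B, ∀ j, hilbertSamuel S C j ≤ B * (j + 1) ^ s) →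
    (∀ i ≥ n, Subsingleton (Ext (ModuleCat.of R M) (ModuleCat.of R C) i)) →
    ∃ L, (∃ c, ∀ j, L * j.choose s ≤ hilbertSamuel S C (j + c)) ∧ hilbertSamuel S C 1 ≤ L ∧
      (L = hilbertSamuel S C 1 → ∃ (D : Type u) (_ : AddCommGroup D) (_ : Module R D), Nontrivial D ∧
        (∀ r ∈ IsLocalRing.maximalIdeal R, ∀ d : D, r • d = 0) ∧
        ∀ i ≥ n, Subsingleton (Ext (ModuleCat.of R M) (ModuleCat.of R D) i)) := by
  intro s
  induction s with
  | zero =>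
    intro S _ _ _ _ _ C _ _ _ _ _ _ _ ⟨B, hB⟩ hExt
    obtain ⟨k, hk, hbot⟩ := Submodule.exists_pow_smul_eq_bot_of_length_le (M := C) (L := B) (k := 1)
      (le_refl (IsLocalRing.maximalIdeal S)) (fun j _ ↦ by
        rw [← coe_hilbertSamuel]; exact_mod_cast (hB j).trans (by simp))
    -- In degree zero `L` is the length of `C`, since `𝔪ᵏC = 0`. If it equals the length of `C /
    -- 𝔪C`, then `𝔪C = 0` and `C` itself serves as the required module.
    refine ⟨hilbertSamuel S C k, ⟨k, fun j ↦ ?_⟩, hilbertSamuel_mono C hk, fun h ↦ ?_⟩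
    · rw [Nat.choose_zero_right, mul_one]
      exact hilbertSamuel_mono C (by omega)
    · have h1 : IsLocalRing.maximalIdeal S ^ 1 • (⊤ : Submodule S C) = ⊥ := by
        by_contra hne
        have hlt : IsLocalRing.maximalIdeal S ^ k • (⊤ : Submodule S C) <
            IsLocalRing.maximalIdeal S ^ 1 • ⊤ := hbot ▸ bot_lt_iff_ne_bot.mpr hne
        have := Order.coheight_strictAnti hlt (by
          rw [← Module.length_quotient]
          exact (length_quotient_pow_maximalIdeal_ne_top C 1).lt_top)
        rw [← Module.length_quotient, ← Module.length_quotient, ← coe_hilbertSamuel,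
          ← coe_hilbertSamuel, h] at this
        exact lt_irrefl _ this
      refine ⟨C, ‹_›, ‹_›, ‹_›, fun r hr d ↦ ?_, hExt⟩
      have hr' : algebraMap R S r ∈ IsLocalRing.maximalIdeal S := by
        have : IsLocalRing.maximalIdeal R ≤ (IsLocalRing.maximalIdeal S).comap (algebraMap R S) :=
          ((IsLocalRing.local_hom_TFAE (algebraMap R S)).out 0 3).mp ‹_›
        exact this hr
      rw [← algebraMap_smul S r d, ← Submodule.mem_bot S, ← h1, pow_one]
      exact Submodule.smul_mem_smul hr' trivial
  | succ s ih =>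
    intro S _ _ _ _ _ C _ _ _ _ _ _ hdepth ⟨B, hB⟩ hExt
    obtain ⟨x, hx, hxreg⟩ := IsLocalRing.exists_isSMulRegular (M := C)
      fun v hv ↦ (hdepth.mono (by omega)).eq_zero_of_smul hv
    obtain ⟨S', _, _, _, _, ξ, hξ⟩ := exists_isGenericExtension S
    obtain ⟨y, hy, hyreg, n₀, hn₀⟩ := hξ.exists_superficial hx hxreg
    have hflat := hξ.flat
    have hloc : IsLocalHom (algebraMap S S') :=
      ((IsLocalRing.local_hom_TFAE (algebraMap S S')).out 2 0).mp hξ.map_maximalIdeal.le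
    -- The map from `R` stays local, so that in the end a module killed by the maximal ideal of the
    -- last ring is killed by that of `R`.
    let _ : Algebra R S' := ((algebraMap S S').comp (algebraMap R S)).toAlgebra
    have : IsScalarTower R S S' := IsScalarTower.of_algebraMap_eq' rfl
    have : IsLocalHom (algebraMap R S') :=
      inferInstanceAs (IsLocalHom ((algebraMap S S').comp (algebraMap R S)))
    have hff : Module.FaithfullyFlat S S' := Module.FaithfullyFlat.of_flat_of_isLocalHom
    have hC' : Nontrivial (S' ⊗[S] C) := inferInstance
    have hhC := hilbertSamuel_baseChange hξ.map_maximalIdeal C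
    let D := QuotSMulTop y (S' ⊗[S] C)
    have hD : Nontrivial D := by
      refine Submodule.Quotient.nontrivial_iff.mpr (ne_of_lt (lt_of_le_of_lt ?_
        (IsLocalRing.maximalIdeal_smul_top_lt (R := S') (M := S' ⊗[S] C))))
      intro z hz
      obtain ⟨w, -, rfl⟩ := (Submodule.mem_smul_pointwise_iff_exists _ _ _).mp hz
      exact Submodule.smul_mem_smul hy trivial
    have hdepth' : ExtResidueVanishes S' (S' ⊗[S] C) (s + 1) := by
      obtain ⟨rs, hlen, hmem, hreg⟩ := hdepth.exists_isRegular
      rw [← hlen, ← List.length_map (algebraMap S S')]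
      refine ExtResidueVanishes.of_isWeaklyRegular
        (hreg.toIsWeaklyRegular.of_flat_of_isBaseChange (TensorProduct.isBaseChange S C S')) ?_
      intro r hr
      obtain ⟨t, ht, rfl⟩ := List.mem_map.mp hr
      exact hξ.map_maximalIdeal ▸ Ideal.mem_map_of_mem _ (hmem t ht)
    have hstep : ∀ j ≥ n₀, hilbertSamuel S C (j + 1) =
        hilbertSamuel S C j + hilbertSamuel S' D (j + 1) := by
      intro j hj
      rw [← hhC, ← hhC]
      exact hilbertSamuel_succ_eq_add hy (hn₀ j hj)
    have hExt' : ∀ i ≥ n, Subsingleton (Ext (ModuleCat.of R M) (ModuleCat.of R (S' ⊗[S] C)) i) := by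
      intro i hi
      obtain ⟨i, rfl⟩ : ∃ k, i = k + 1 := ⟨i - 1, by omega⟩
      exact subsingleton_ext_tensorProduct i (hExt _ hi)
    have hExtD : ∀ i ≥ n, Subsingleton (Ext (ModuleCat.of R M) (ModuleCat.of R D) i) := fun i hi ↦
      subsingleton_ext_quotient_smul_top hyreg _ i (hExt' i hi) (hExt' (i + 1) (by omega)) rfl
    obtain ⟨L, ⟨c, hc⟩, hL, hLD⟩ := ih S' D
      (hdepth'.quotSMulTop hyreg)
      (exists_le_mul_pow_of_succ_eq_add (hilbertSamuel_mono D) hstep hB) hExtD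
    have h1 : hilbertSamuel S' D 1 = hilbertSamuel S C 1 :=
      (hilbertSamuel_quotSMulTop_one hy).trans (hhC 1)
    rw [h1] at hL hLD
    exact ⟨L, exists_mul_choose_le_of_succ_eq_add (hilbertSamuel_mono D) hstep hc, hL, hLD⟩

end Hilbert

/-! ### Freeness from vanishing against a vector space -/

section FreeCriterion

open scoped TensorProduct

variable {R : Type u} [CommRing R] [IsLocalRing R] [IsNoetherianRing R]

/-- Over a Noetherian local ring, vanishing of `Ext^1(X, D)` for a single nonzero module `D` killed
by the maximal ideal makes `X` free. -/
theorem Module.free_of_subsingleton_ext_one {D : Type u} [AddCommGroup D] [Module R D] [Nontrivial D]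
    (hD : ∀ r ∈ IsLocalRing.maximalIdeal R, ∀ d : D, r • d = 0) {X : Type u} [AddCommGroup X]
    [Module R X] [Module.Finite R X]
    (h : Subsingleton (Ext (ModuleCat.of R X) (ModuleCat.of R D) 1)) : Module.Free R X := by
  obtain ⟨n, p, hp⟩ := Module.Finite.exists_fin' R X
  have hext := (subsingleton_ext_one_iff (LinearMap.ker p).injective_subtype
    (LinearMap.exact_subtype_ker_map p) hp D).mp h
  refine Module.free_of_lTensor_residueField_injective (LinearMap.ker p).subtype p hp
    (LinearMap.exact_subtype_ker_map p) ?_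
  obtain ⟨d, hd⟩ := exists_ne (0 : D)
  let δ : IsLocalRing.ResidueField R →ₗ[R] D :=
    Submodule.liftQ _ (LinearMap.toSpanSingleton R D d) fun r hr ↦ hD r hr d
  have hδ : Function.Injective δ := by
    rw [injective_iff_map_eq_zero]
    intro z hz
    obtain ⟨r, rfl⟩ := IsLocalRing.residue_surjective z
    rw [IsLocalRing.residue_eq_zero_iff]
    by_contra hr
    have hu : IsUnit r := by simpa using hr
    exact hd ((hu.smul_eq_zero).mp hz)
  rw [injective_iff_map_eq_zero]
  intro z hz
  by_contra hz0
  -- A nonzero `1 ⊗ κ` dying in `k ⊗ Rⁿ` would have `κ ∈ 𝔪Rⁿ`. A functional nonzero on it, followed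
  -- by `k → D`, extends to `ψ` on `Rⁿ`; but `ψ κ ∈ 𝔪D = 0`.
  obtain ⟨χ, hχ⟩ : ∃ χ : Module.Dual (IsLocalRing.ResidueField R)
      (IsLocalRing.ResidueField R ⊗[R] LinearMap.ker p), χ z ≠ 0 := by
    by_contra! h0
    exact hz0 ((Module.forall_dual_apply_eq_zero_iff _ z).mp h0)
  obtain ⟨κ, rfl⟩ := TensorProduct.mk_surjective R (LinearMap.ker p) (IsLocalRing.ResidueField R)
    IsLocalRing.residue_surjective z
  obtain ⟨ψ, hψ⟩ := hext (δ ∘ₗ χ.restrictScalars R ∘ₗ TensorProduct.mk R _ _ 1)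
  have hκ : (κ : Fin n → R) ∈ IsLocalRing.maximalIdeal R • (⊤ : Submodule R (Fin n → R)) := by
    rw [← Submodule.Quotient.mk_eq_zero,
      ← TensorProduct.quotTensorEquivQuotSMul_mk_one_tmul (IsLocalRing.maximalIdeal R)]
    exact (LinearEquiv.map_eq_zero_iff _).mpr hz
  have hψκ : ψ κ = 0 := by
    have h1 : ψ κ ∈ (IsLocalRing.maximalIdeal R • (⊤ : Submodule R (Fin n → R))).map ψ :=
      Submodule.mem_map_of_mem hκ
    rw [Submodule.map_smul''] at h1
    refine Submodule.smul_induction_on h1 (fun r hr d _ ↦ hD r hr d) fun a b ha hb ↦ ?_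
    rw [ha, hb, add_zero]
  exact hχ (hδ ((LinearMap.congr_fun hψ κ).symm.trans (hψκ.trans (map_zero δ).symm)))

/-- Induction along syzygies makes the first syzygy free. Since `Ext^1(X, R) = 0`, its coordinate
functions extend to the free cover and assemble to a retraction, so `X` is projective. -/
theorem Module.free_of_extPosVanishes_of_subsingleton_ext {D : Type u} [AddCommGroup D] [Module R D]
    [Nontrivial D] (hD : ∀ r ∈ IsLocalRing.maximalIdeal R, ∀ d : D, r • d = 0) (m : ℕ) {X : Type u}
    [AddCommGroup X] [Module R X] [Module.Finite R X] (hX : LocalAlg.ExtPosVanishes R X R)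
    (h : ∀ i > m, Subsingleton (Ext (ModuleCat.of R X) (ModuleCat.of R D) i)) :
    Module.Free R X := by
  induction m generalizing X with
  | zero => exact Module.free_of_subsingleton_ext_one hD (h 1 one_pos)
  | succ m ih =>
    obtain ⟨n, p, hp⟩ := Module.Finite.exists_fin' R X
    have hι := (LinearMap.ker p).injective_subtype
    have hιp := LinearMap.exact_subtype_ker_map p
    have hfree : Module.Free R (LinearMap.ker p) := by
      refine ih (fun i hi ↦ ?_) fun i hi ↦ ?_
      · obtain ⟨i, rfl⟩ := Nat.exists_eq_add_one.mpr hi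
        exact (subsingleton_ext_succ_iff hι hιp hp R i).mp (hX _ (by omega))
      · obtain ⟨i, rfl⟩ := Nat.exists_eq_add_one.mpr (pos_of_gt hi)
        exact (subsingleton_ext_succ_iff hι hιp hp D i).mp (h _ (by omega))
    have hext := (subsingleton_ext_one_iff hι hιp hp R).mp (hX 1 one_pos)
    let b := Module.Free.chooseBasis R (LinearMap.ker p)
    choose ψ hψ using fun j ↦ hext (b.coord j)
    let l : (Fin n → R) →ₗ[R] LinearMap.ker p := ∑ j, (ψ j).smulRight (b j)
    have hl : l ∘ₗ (LinearMap.ker p).subtype = LinearMap.id := by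
      ext1 z
      have hz : ∀ j, ψ j z = b.repr z j := fun j ↦ LinearMap.congr_fun (hψ j) z
      simp [l, hz, b.sum_repr]
    obtain ⟨σ, hσ⟩ := ((hιp.split_tfae hι hp).out 1 0).mp (⟨l, hl⟩ :
      ∃ l, l ∘ₗ (LinearMap.ker p).subtype = LinearMap.id)
    have : Module.Projective R X := Module.Projective.of_split σ p hσ
    exact Module.free_of_flat_of_isLocalRing

end FreeCriterion

/-! ### Comparing the multiplicity with Hilbert–Samuel bounds -/

section Multiplicity

theorem exists_le_mul_pow_of_tendsto {h : ℕ → ℕ} {s : ℕ} {e : ℝ}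
    (he : Tendsto (fun n : ℕ ↦ (s.factorial : ℝ) * (h n : ℝ) / (n : ℝ) ^ s) atTop (𝓝 e)) :
    ∃ B, ∀ j, h j ≤ B * (j + 1) ^ s := by
  obtain ⟨K, hK⟩ := he.bddAbove_range
  refine ⟨⌈K⌉₊ + h 0, fun j ↦ ?_⟩
  rcases j.eq_zero_or_pos with rfl | hj
  · simp
  · have h1 : (s.factorial : ℝ) * (h j : ℝ) / (j : ℝ) ^ s ≤ K := hK ⟨j, rfl⟩
    rw [div_le_iff₀ (by positivity)] at h1
    have h2 : (h j : ℝ) ≤ (s.factorial : ℝ) * (h j : ℝ) :=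
      le_mul_of_one_le_left (by positivity) (by exact_mod_cast s.factorial_pos)
    have h3 : K * (j : ℝ) ^ s ≤ ⌈K⌉₊ * ((j : ℝ) + 1) ^ s :=
      mul_le_mul (Nat.le_ceil K) (by gcongr; linarith) (by positivity) (by positivity)
    have h4 : h j ≤ ⌈K⌉₊ * (j + 1) ^ s := by exact_mod_cast (h2.trans h1).trans h3
    exact h4.trans (Nat.mul_le_mul_right _ (Nat.le_add_right _ _))

theorem le_of_tendsto_of_mul_choose_le {h : ℕ → ℕ} {s L c : ℕ} {e : ℝ}
    (he : Tendsto (fun n : ℕ ↦ (s.factorial : ℝ) * (h n : ℝ) / (n : ℝ) ^ s) atTop (𝓝 e))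
    (hL : ∀ j, L * j.choose s ≤ h (j + c)) : (L : ℝ) ≤ e := by
  -- The shift by `s` comes from `j ^ s ≤ s! * choose (j + s) s`, the shift by `c` from `hL`; the
  -- ratio `j / (j + s + c)` tends to 1.
  have h1 : Tendsto (fun j : ℕ ↦ (L : ℝ) * ((j : ℝ) / (j + (s + c : ℕ))) ^ s) atTop (𝓝 L) := by
    simpa using ((tendsto_natCast_div_add_atTop ((s + c : ℕ) : ℝ)).pow s).const_mul (L : ℝ)
  refine le_of_tendsto_of_tendsto h1 (he.comp (tendsto_add_atTop_nat (s + c))) ?_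
  filter_upwards [eventually_gt_atTop 0] with j hj
  have h2 : L * j ^ s ≤ s.factorial * h (j + (s + c)) := by
    refine le_trans ?_ (Nat.mul_le_mul_left _ (add_assoc j s c ▸ hL (j + s)))
    rw [mul_left_comm, ← Nat.descFactorial_eq_factorial_mul_choose]
    refine Nat.mul_le_mul_left _ (le_trans (Nat.pow_le_pow_left ?_ s)
      (Nat.pow_sub_le_descFactorial (j + s) s))
    omega
  rw [Function.comp_apply, div_pow, ← mul_div_assoc, Nat.cast_add j]
  exact div_le_div_of_nonneg_right (by exact_mod_cast h2) (by positivity)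

theorem spanFinrank_le_hilbertSamuel_one (R : Type*) [CommRing R] [IsLocalRing R]
    [IsNoetherianRing R] (C : Type*) [AddCommGroup C] [Module R C] [Module.Finite R C] :
    (⊤ : Submodule R C).spanFinrank ≤ hilbertSamuel R C 1 := by
  let _ : Field (R ⧸ IsLocalRing.maximalIdeal R) := Ideal.Quotient.field _
  let e : ((⊤ : Submodule R C) ⧸ (IsLocalRing.maximalIdeal R • (⊤ : Submodule R (⊤ : Submodule R C))))
      ≃ₗ[R] C ⧸ (IsLocalRing.maximalIdeal R ^ 1 • (⊤ : Submodule R C)) :=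
    Submodule.Quotient.equiv _ _ Submodule.topEquiv (by
      rw [Submodule.map_smul'', Submodule.map_top, LinearEquiv.range, pow_one])
  rw [IsLocalRing.spanFinrank_eq_finrank_quotient _ Module.Finite.fg_top,
    ← Nat.cast_le (α := ℕ∞), coe_hilbertSamuel, ← e.length_eq,
    Module.length_eq_of_surjective (R := R ⧸ IsLocalRing.maximalIdeal R) Ideal.Quotient.mk_surjective]
  have : Module.Finite (R ⧸ IsLocalRing.maximalIdeal R)
      ((⊤ : Submodule R C) ⧸ (IsLocalRing.maximalIdeal R • (⊤ : Submodule R (⊤ : Submodule R C)))) :=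
    Module.Finite.of_restrictScalars_finite R _ _
  rw [Module.length_eq_finrank]

end Multiplicity

/-! ### Conclusion -/

section Main

variable {R : Type u} [CommRing R]

theorem LocalAlg.FiniteInjectiveDimension.of_linearEquiv {A B : Type u} [AddCommGroup A] [Module R A]
    [AddCommGroup B] [Module R B] (e : A ≃ₗ[R] B) (h : LocalAlg.FiniteInjectiveDimension R B) :
    LocalAlg.FiniteInjectiveDimension R A := by
  obtain ⟨n, hn⟩ := h
  exact ⟨n, (Retract.ofIso e.toModuleIso).hasInjectiveDimensionLT n⟩

variable [IsLocalRing R]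

/-- In dimension zero an embedding of `R` into a canonical module is an isomorphism. -/
theorem bijective_of_length_linearMap_le_one {ω : Type u} [AddCommGroup ω] [Module R ω]
    (hR : Module.length R R ≠ ⊤)
    (hω : Module.length R (IsLocalRing.ResidueField R →ₗ[R] ω) ≤ 1) {f : R →ₗ[R] ω}
    (hf : Function.Injective f) : Function.Bijective f := by
  have hle := Module.length_le_length_of_smul_eq_zero hω (π := LinearMap.id (R := R) (M := R))
    Function.surjective_id (fun r hr w ↦ by rw [show r = 0 from hr, zero_smul]) hR
  refine ⟨hf, ?_⟩
  have h1 := Module.length_eq_add_of_exact f (LinearMap.range f).mkQ hf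
    (Submodule.mkQ_surjective _) (LinearMap.exact_map_mkQ_range f)
  rw [h1] at hle
  have h2 : Module.length R (ω ⧸ LinearMap.range f) = 0 := by
    by_contra h0
    exact hle.not_gt (add_comm (Module.length R R) _ ▸ ENat.lt_add_left hR (pos_iff_ne_zero.mpr h0))
  rw [Module.length_eq_zero_iff, Submodule.Quotient.subsingleton_iff] at h2
  exact LinearMap.range_eq_top.mp h2

end Main

end

theorem corollary4p6 (R : Type u) [CommRing R] [IsNoetherianRing R] [IsLocalRing R]
    (hCM : LocalAlg.IsCohenMacaulay R) (hAG : LocalAlg.IsAlmostGorenstein R)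
    (hnG : ¬ LocalAlg.IsGorenstein R) (hES : LocalAlg.SatisfiesES R R 1)
    (M : Type u) [AddCommGroup M] [Module R M] [Module.Finite R M]
    (hM : LocalAlg.ExtPosVanishes R M R) :
    Module.Free R M := by
  obtain ⟨ω, _, _, C, _, _, f, g, hω, hf, hfg, hg, hmult⟩ := hAG
  have hωfin := hω.finite
  have hCfin : Module.Finite R C := Module.Finite.of_surjective g hg
  have hnb : ¬ Function.Bijective f := fun hb ↦
    hnG (hω.finiteInjectiveDimension.of_linearEquiv (LinearEquiv.ofBijective f hb))
  have hCnt : Nontrivial C := by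
    by_contra hC
    rw [not_nontrivial_iff_subsingleton] at hC
    exact hnb ⟨hf, fun w ↦ (hfg w).mp (Subsingleton.elim _ _)⟩
  obtain ⟨d, hd⟩ : ∃ d : ℕ, ringKrullDim R = d := by
    obtain ⟨d, hd⟩ := WithBot.ne_bot_iff_exists.mp (ringKrullDim_ne_bot (R := R))
    obtain ⟨d, rfl⟩ := ENat.ne_top_iff_exists.mp
      (fun ht ↦ ringKrullDim_ne_top (R := R) (by rw [← hd, ht]; rfl) : d ≠ ⊤)
    exact ⟨d, hd.symm⟩
  have hdR : LocalAlg.depth R R = d := by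
    exact_mod_cast (show ((LocalAlg.depth R R : ℕ∞) : WithBot ℕ∞) = ringKrullDim R from hCM).trans hd
  have hdω : LocalAlg.depth R ω = d := by
    exact_mod_cast (show ((LocalAlg.depth R ω : ℕ∞) : WithBot ℕ∞) = ringKrullDim R from
      hω.maximalCohenMacaulay).trans hd
  have htype := hω.type_one
  rw [LocalAlg.cmType, hdω, ENat.toNat_natCast] at htype
  have hdim : Module.supportDim R R ≤ d := by
    rw [Module.supportDim_self_eq_ringKrullDim, hd]
  -- In dimension zero a length count would make `f` bijective, hence `R` Gorenstein.
  obtain ⟨n, rfl⟩ : ∃ n, d = n + 1 := by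
    refine Nat.exists_eq_add_one.mpr (Nat.pos_of_ne_zero ?_)
    rintro rfl
    exact hnb (bijective_of_length_linearMap_le_one
      (Module.length_ne_top_of_supportDim_le_zero hdim)
      (by rw [length_linearMap_eq_length_ext_zero, htype]) hf)
  have hER := LocalAlg.extResidueVanishes_of_le_depth hdR.ge
  have hEω := LocalAlg.extResidueVanishes_of_le_depth hdω.ge
  have hCdim := supportDim_cokernel_le n hf hfg hg (π := LinearMap.id) Function.surjective_id
    (fun r hr w ↦ by rw [show r = 0 from hr, zero_smul]) hER hEω htype.le hdim
  have hEC := ExtResidueVanishes.of_exact hf hfg hg hER (hEω.mono n.le_succ)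
  set s := ((Module.supportDim R C).unbotD 0).toNat with hs
  have hsn : s ≤ n := by
    refine ENat.toNat_le_of_le_natCast ?_
    exact (WithBot.unbotD_le_iff (fun _ ↦ zero_le)).mpr hCdim
  obtain ⟨m, hm⟩ := hω.finiteInjectiveDimension
  -- Degrees from `m` on would do for `ω`; starting at `m + 1` keeps them positive, as the flat base
  -- change of Ext requires.
  have hExtC : ∀ i ≥ m + 1, Subsingleton (Ext (ModuleCat.of R M) (ModuleCat.of R C) i) :=
    fun i hi ↦ subsingleton_ext_of_exact_covariant hf hfg hg _ i
      (HasInjectiveDimensionLT.subsingleton _ m i (by omega) _) (hM _ (by omega))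
  have hmult' : Tendsto (fun n : ℕ ↦ (s.factorial : ℝ) * (hilbertSamuel R C n : ℝ) / (n : ℝ) ^ s)
    atTop (𝓝 ((⊤ : Submodule R C).spanFinrank : ℝ)) := hmult
  obtain ⟨L, ⟨c, hc⟩, hL1, hL⟩ := exists_hilbertSamuel_bound m.succ_pos s R C (hEC.mono hsn)
    (exists_le_mul_pow_of_tendsto hmult') hExtC
  have hL2 : L ≤ (⊤ : Submodule R C).spanFinrank := by
    exact_mod_cast le_of_tendsto_of_mul_choose_le hmult' hc
  -- The chain `L ≤ e(C) = μ(C) ≤ hilbertSamuel R C 1 ≤ L` forces the equality case.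
  obtain ⟨D, _, _, hDnt, hD, hExtD⟩ :=
    hL ((hL2.trans (spanFinrank_le_hilbertSamuel_one R C)).antisymm hL1)
  exact Module.free_of_extPosVanishes_of_subsingleton_ext hD m hM hExtD
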